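/- Let $m\in\mathbb N$, $d_1,\dots,d_m\in\mathbb R$ and $\lambda_1,\dots,\lambda_m>0$. Let $Y$ be a random variable with an absolutely continuous distribution $\eta$ on $(0,\infty)$ such that, for some $C_1>0$, $\frac{d\eta}{dx}\le C_1x^{-1}$ for (a.e.) $x>0$, and such that $\mathbb E\,|\log Y|<\infty$. Let $\eta_\infty=\eta^{\mathbb N}$ be the product measure on $\mathbb R^{\mathbb N}$. Let $\Sigma=\{1,\dots,m\}^{\mathbb N}$ with the left shift $\sigma$, let $\mu$ be an ergodic $\sigma$-invariant Borel probability measure on $\Sigma$, and let $$h(\mu)=\lim_{n\to\infty}\frac1n\sum_{w\in\{1,\dots,m\}^n}-\mu[w]\log\mu[w]$$ be its entropy, where $[w]$ is the cylinder set of sequences starting with $w$. Put $$\chi=\chi(\mu,\eta)=\mathbb E[\log Y]+\int_\Sigma\log\lambda_{i_1}\,d\mu(\mathbf i)$$ and assume $\chi<0$. Assume moreover that either $d_i\ne d_j$ for all $i\neq j$, or $d_i=1$ for all $i$ and $\lambda_i\ne\lambda_j$ for all $i\ne j$. Then for $\eta_\infty$-a.e. $\mathbf y=(y_1,y_2,\dots)$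 the series $$\Pi_{\mathbf y}(\mathbf i)=d_{i_1}+\sum_{n\ge1}d_{i_{n+1}}\lambda_{i_1}\cdots\lambda_{i_n}\,y_1\cdots y_n$$ converges absolutely for $\mu$-a.e. $\mathbf i\in\Sigma$. Let $\nu_{\mathbf y}=(\Pi_{\mathbf y})_*\mu$ (the conditional distribution of the sum given $\mathbf y$), and for a measure $\nu$ on $\mathbb R$ let $\dim_H\nu=\inf\{\dim_H A:\ \nu(\mathbb R\setminus A)=0\}$. Then: (a) If $h(\mu)>|\chi|$, then $\nu_{\mathbf y}$ is absolutely continuous with respect to Lebesgue measure for $\eta_\infty$-a.e. $\mathbf y$. (b) If $h(\mu)\le|\chi|$, then $\dim_H\nu_{\mathbf y}=\dfrac{h(\mu)}{|\chi|}$ for $\eta_\infty$-a.e. $\mathbf y$. -/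

import Mathlib

open MeasureTheory Filter Topology
open scoped ENNReal

noncomputable section

namespace RandomIFS

/-- The symbolic space of infinite sequences over an alphabet with `m` letters
(indexed from `0`: `i 0` is the first letter). -/
abbrev Seq (m : ℕ) : Type := ℕ → Fin m

/-- The left shift. -/
def shift {m : ℕ} (i : Seq m) : Seq m := fun n => i (n + 1)

/-- The cylinder set of sequences that start with the word `w`. -/
def wordCylinder {m n : ℕ} (w : Fin n → Fin m) : Set (Seq m) :=
  {i | ∀ k : Fin n, i k = w k}

/-- Shannon entropy (natural logarithm) of the first `n` letters under `μ`:
the sum of `-μ[w] log μ[w]` over all words `w` of length `n`, with `0 log 0 = 0`. -/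
def blockEntropy {m : ℕ} (μ : Measure (Seq m)) (n : ℕ) : ℝ :=
  ∑ w : Fin n → Fin m, Real.negMulLog (μ.real (wordCylinder w))

/-- The entropy `h(μ)` of the stationary process with law `μ`: the limit of `H_n / n`.
For a shift-invariant probability measure the limit exists by subadditivity; writing it as a
`limsup` (of a bounded sequence) makes the definition independent of that fact. -/
def entropy {m : ℕ} (μ : Measure (Seq m)) : ℝ :=
  limsup (fun n : ℕ => blockEntropy μ n / n) atTop

/-- The Lyapunov exponent `χ(μ, η) = E[log Y] + ∫ log λ_{i₁} dμ(i)`, where `Y` has law `η`. -/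
def lyapunov {m : ℕ} (lam : Fin m → ℝ) (μ : Measure (Seq m)) (η : Measure ℝ) : ℝ :=
  (∫ y, Real.log y ∂η) + ∫ i : Seq m, Real.log (lam (i 0)) ∂μ

/-- The `n`-th term `d_{i_{n+1}} λ_{i_1} ⋯ λ_{i_n} y_1 ⋯ y_n` of the series defining `Π(i, y)`
(indices in the code start at `0`). -/
def term {m : ℕ} (d lam : Fin m → ℝ) (y : ℕ → ℝ) (i : Seq m) (n : ℕ) : ℝ :=
  d (i n) * (∏ k ∈ Finset.range n, lam (i k)) * ∏ k ∈ Finset.range n, y k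

/-- The natural projection `Π_y(i) = ∑ₙ d_{i_{n+1}} λ_{i_1 … i_n} y_{1 … n}`. -/
def proj {m : ℕ} (d lam : Fin m → ℝ) (y : ℕ → ℝ) (i : Seq m) : ℝ :=
  ∑' n : ℕ, term d lam y i n

/-- For every fixed sequence of errors `y` the projection `Π_y` is a Borel map, so that the
push-forward below is a genuine one (never the default value of `Measure.map`). -/
theorem measurable_proj {m : ℕ} (d lam : Fin m → ℝ) (y : ℕ → ℝ) :
    Measurable (proj d lam y) := by
  have ht : ∀ n, Measurable (fun i : Seq m => term d lam y i n) := by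
    intro n
    have h1 : ∀ (f : Fin m → ℝ) (k : ℕ), Measurable (fun i : Seq m => f (i k)) := fun f k =>
      (measurable_of_finite f).comp (measurable_pi_apply k)
    exact ((h1 d n).mul (Finset.measurable_prod _ fun k _ => h1 lam k)).mul_const _
  exact Measurable.tsum ht

/-- The conditional measure `ν_y = (Π_y)_* μ`. -/
def condMeasure {m : ℕ} (d lam : Fin m → ℝ) (μ : Measure (Seq m)) (y : ℕ → ℝ) : Measure ℝ :=
  μ.map (proj d lam y)

/-- The Hausdorff dimension of a measure on the line:
`dim_H ν = inf {dim_H A : ν(ℝ ∖ A) = 0}`. -/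
def measureDimH (ν : Measure ℝ) : ℝ≥0∞ :=
  ⨅ (A : Set ℝ) (_ : ν Aᶜ = 0), dimH A

end RandomIFS

end

/-!
Fix `y`. The measure `ν_y` is an image of `μ` on which two independent mechanisms act: the entropy
`h = h(μ)` says that `μ` gives mass about `exp (-n h)` to a typical cylinder of length `n`, and the
Lyapunov exponent `χ` says that such a cylinder is contracted by `Π_y` to length about `exp (n χ)`.
The ratio `h / |χ|` is therefore an upper bound for the dimension; the randomness of `y` shows that
overlaps of cylinders do not lower it below `min (1, h / |χ|)`, and that they leave a density when
the ratio exceeds `1`.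

*Mass of cylinders.* What is needed is that almost surely `μ[i₁ … iₙ] ≤ exp (-n (h - ε))` for large
`n`. Let `g(i)` be the conditional probability of the first letter of `i` given all the later ones.
Integrating over the first letter first shows that `μ[i₁ … iₙ] / ∏ g(σᵏ i)` has mean at most `1`
(`lintegral_prefix_mul_prod_inv_le`), so by Borel–Cantelli it is almost surely at most `(n + 1)²`
for large `n`. The ergodic theorem (`ae_tendsto_birkhoffSum_div`, proved from the maximal ergodic
lemma) gives the exponential rate `∫ -log g` of the product, and Lévy's upward theorem identifies
this integral with `h` (`entropy_eq_condEntropy`). As `-log μ[i₁ … iₙ] / n` has mean tending to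
`h`, this one-sided bound also forces convergence in `L¹`, hence almost surely along a subsequence
(`exists_subseq_ae_tendsto_information`).

*Upper bound.* Along that subsequence `exp (n (h + ε))` intervals of length about `exp (n (χ + ε))`
cover a set of full measure (`ae_measureDimH_le`); one sequence of scales is enough to bound the
Hausdorff measure.

*Transversality.* If `i` and `j` first differ at position `n`, then `Π_y(i) - Π_y(j)` is
`λ_{i₁ … iₙ}` times a product of about `n` errors times `a + y_N b`, where `a` is a difference of two
digits (or of two contraction ratios) and `b` depends on the errors after `y_N` only
(`exists_proj_sub_proj_eq`). Since the law of `y_N` has density at most `C₁ / x`, the event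
`|a + y_N b| ≤ ρ` has probability `O(ρ)` whatever `b` is (`measure_abs_add_mul_le`). On the set of
`y` and `i` for which the exponential growth rates hold with uniform constants, summing over `n`
gives `E (ν_y ⊗ ν_y) {|x - x'| ≤ r} = O(r ^ s)` for `s ≤ 1` with `s |χ| < h`
(`exists_lintegral_ballEnergy_le`).

*Conclusions.* With `s = 1`, Fatou's lemma makes the lower density of `ν_y` finite almost everywhere
and the Besicovitch covering theorem gives absolute continuity. With `s < h / |χ|`, summing over
dyadic `r` bounds the masses of balls and the mass distribution principle bounds the dimension from
below.
-/

/-! ### The pointwise ergodic theorem -/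

section BirkhoffErgodic

variable {α : Type*} {T : α → α} {f : α → ℝ}

/-- The running maximum `max (0, S₁ f, …, Sₙ f)` of the Birkhoff sums, defined through the
recursion `Mₙ₊₁ = max (0, f + Mₙ ∘ T)` that carries the maximal ergodic lemma. -/
def birkhoffMax (T : α → α) (f : α → ℝ) : ℕ → α → ℝ
  | 0 => fun _ => 0
  | n + 1 => fun x => max 0 (f x + birkhoffMax T f n (T x))

theorem birkhoffMax_nonneg (n : ℕ) (x : α) : 0 ≤ birkhoffMax T f n x := by
  cases n with
  | zero => exact le_rfl
  | succ n => exact le_max_left _ _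

theorem birkhoffMax_le_succ (n : ℕ) (x : α) :
    birkhoffMax T f n x ≤ birkhoffMax T f (n + 1) x := by
  induction n generalizing x with
  | zero => exact le_max_left _ _
  | succ n ih =>
    change max 0 _ ≤ max 0 _
    gcongr
    exact ih _

theorem birkhoffSum_le_birkhoffMax (n : ℕ) (x : α) :
    birkhoffSum T f n x ≤ birkhoffMax T f n x := by
  induction n generalizing x with
  | zero => simp [birkhoffMax]
  | succ n ih =>
    rw [birkhoffSum_succ']
    exact le_max_of_le_right (by gcongr; exact ih _)

variable [MeasurableSpace α] {μ : Measure α}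

theorem measurable_birkhoffMax (hT : Measurable T) (hf : Measurable f) (n : ℕ) :
    Measurable (birkhoffMax T f n) := by
  induction n with
  | zero => exact measurable_const
  | succ n ih => exact measurable_const.max (hf.add (ih.comp hT))

theorem integrable_birkhoffMax (hT : MeasurePreserving T μ μ)
    (hfi : Integrable f μ) (n : ℕ) : Integrable (birkhoffMax T f n) μ := by
  induction n with
  | zero => exact integrable_zero _ _ _
  | succ n ih => exact (integrable_zero _ _ _).sup (hfi.add (hT.integrable_comp_of_integrable ih))

/-- The maximal ergodic lemma, for the running maximum of finitely many Birkhoff sums. -/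
theorem setIntegral_birkhoffMax_pos_nonneg (hT : MeasurePreserving T μ μ) (hf : Measurable f)
    (hfi : Integrable f μ) (n : ℕ) :
    0 ≤ ∫ x in {x | 0 < birkhoffMax T f n x}, f x ∂μ := by
  cases n with
  | zero => simp [birkhoffMax]
  | succ n =>
    set E : Set α := {x | 0 < birkhoffMax T f (n + 1) x} with hE
    have hEm : MeasurableSet E :=
      measurableSet_lt measurable_const (measurable_birkhoffMax hT.measurable hf _)
    have hi := integrable_birkhoffMax hT hfi n
    have hi1 := integrable_birkhoffMax hT hfi (n + 1)
    have hic : Integrable (fun x => birkhoffMax T f n (T x)) μ := hT.integrable_comp_of_integrable hi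
    have h1 : ∫ x in E, f x ∂μ
        = ∫ x in E, (birkhoffMax T f (n + 1) x - birkhoffMax T f n (T x)) ∂μ := by
      refine setIntegral_congr_fun hEm fun x hx => ?_
      have hx' : 0 < max 0 (f x + birkhoffMax T f n (T x)) := hx
      have : birkhoffMax T f (n + 1) x = f x + birkhoffMax T f n (T x) := by
        change max 0 _ = _
        rcases lt_max_iff.1 hx' with h | h
        · exact absurd h (lt_irrefl _)
        · exact max_eq_right h.le
      simp [this]
    rw [h1, integral_sub hi1.integrableOn hic.integrableOn]
    have h2 : ∫ x in E, birkhoffMax T f (n + 1) x ∂μ = ∫ x, birkhoffMax T f (n + 1) x ∂μ := by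
      refine setIntegral_eq_integral_of_forall_compl_eq_zero fun x hx => ?_
      exact le_antisymm (not_lt.1 hx) (birkhoffMax_nonneg _ _)
    have h3 : ∫ x in E, birkhoffMax T f n (T x) ∂μ ≤ ∫ x, birkhoffMax T f n (T x) ∂μ :=
      setIntegral_le_integral hic (ae_of_all _ fun x => birkhoffMax_nonneg _ _)
    have h4 : ∫ x, birkhoffMax T f n (T x) ∂μ = ∫ x, birkhoffMax T f n x ∂μ := by
      rw [← integral_map hT.measurable.aemeasurable (f := birkhoffMax T f n)]
      · rw [hT.map_eq]
      · rw [hT.map_eq]; exact hi.aestronglyMeasurable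
    have h5 : ∫ x, birkhoffMax T f n x ∂μ ≤ ∫ x, birkhoffMax T f (n + 1) x ∂μ :=
      integral_mono hi hi1 fun x => birkhoffMax_le_succ n x
    linarith

theorem integral_nonneg_of_ae_exists_birkhoffSum_pos (hT : MeasurePreserving T μ μ)
    (hf : Measurable f) (hfi : Integrable f μ) (h : ∀ᵐ x ∂μ, ∃ n, 0 < birkhoffSum T f n x) :
    0 ≤ ∫ x, f x ∂μ := by
  set E : ℕ → Set α := fun n => {x | 0 < birkhoffMax T f n x}
  have hEm : ∀ n, MeasurableSet (E n) := fun n =>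
    measurableSet_lt measurable_const (measurable_birkhoffMax hT.measurable hf _)
  have hmono : Monotone E := monotone_nat_of_le_succ fun n x (hx : 0 < birkhoffMax T f n x) =>
    hx.trans_le (birkhoffMax_le_succ n x)
  have hlim := tendsto_setIntegral_of_monotone (μ := μ) (f := f) hEm hmono hfi.integrableOn
  have hU : ∫ x in ⋃ n, E n, f x ∂μ = ∫ x, f x ∂μ := by
    have : (⋃ n, E n) =ᵐ[μ] Set.univ := by
      rw [eventuallyEq_univ]
      filter_upwards [h] with x hx
      obtain ⟨n, hn⟩ := hx
      exact Set.mem_iUnion.2 ⟨n, lt_of_lt_of_le hn (birkhoffSum_le_birkhoffMax n x)⟩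
    rw [setIntegral_congr_set this, setIntegral_univ]
  rw [hU] at hlim
  exact ge_of_tendsto' hlim fun n => setIntegral_birkhoffMax_pos_nonneg hT hf hfi n

theorem measurable_birkhoffSum (hT : Measurable T) (hf : Measurable f) (n : ℕ) :
    Measurable (birkhoffSum T f n) :=
  Finset.measurable_sum _ fun k _ => hf.comp (hT.iterate k)

/-- If `f` has negative mean, its Birkhoff sums are almost surely bounded above: the event that
they are not is invariant, and it cannot have full measure by the maximal ergodic lemma. -/
theorem ae_bddAbove_birkhoffSum_of_integral_neg (hT : Ergodic T μ) (hf : Measurable f)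
    (hfi : Integrable f μ) (hneg : ∫ x, f x ∂μ < 0) :
    ∀ᵐ x ∂μ, ∃ M : ℕ, ∀ n, birkhoffSum T f n x ≤ M := by
  set B : Set α := {x | ∀ M : ℕ, ∃ n, (M : ℝ) < birkhoffSum T f n x} with hB
  have hBm : MeasurableSet B := by
    have : B = ⋂ M : ℕ, ⋃ n, {x | (M : ℝ) < birkhoffSum T f n x} := by
      ext x; simp [hB]
    rw [this]
    exact MeasurableSet.iInter fun M => MeasurableSet.iUnion fun n =>
      measurableSet_lt measurable_const (measurable_birkhoffSum hT.measurable hf n)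
  have hinv : T ⁻¹' B = B := by
    ext x
    constructor
    · intro hx M
      obtain ⟨N, hN⟩ := exists_nat_gt ((M : ℝ) - f x)
      obtain ⟨n, hn⟩ := hx N
      exact ⟨n + 1, by rw [birkhoffSum_succ']; linarith⟩
    · intro hx M
      obtain ⟨N, hN⟩ := exists_nat_gt ((M : ℝ) + f x)
      obtain ⟨n, hn⟩ := hx N
      cases n with
      | zero =>
        rw [birkhoffSum_zero] at hn
        exact absurd hn (not_lt.2 (Nat.cast_nonneg N))
      | succ n =>
        rw [birkhoffSum_succ'] at hn
        exact ⟨n, by linarith⟩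
  rcases hT.toPreErgodic.measure_self_or_compl_eq_zero hBm hinv with h | h
  · filter_upwards [measure_eq_zero_iff_ae_notMem.1 h] with x hx
    simpa [hB] using hx
  · exfalso
    refine not_lt.2 (integral_nonneg_of_ae_exists_birkhoffSum_pos hT.toMeasurePreserving hf hfi ?_)
      hneg
    filter_upwards [mem_ae_iff.2 h] with x hx
    simpa using hx 0

theorem ae_eventually_birkhoffSum_le [IsProbabilityMeasure μ] (hT : Ergodic T μ)
    (hf : Measurable f) (hfi : Integrable f μ) {c : ℝ} (hc : ∫ x, f x ∂μ < c) :
    ∀ᵐ x ∂μ, ∀ᶠ n : ℕ in atTop, birkhoffSum T f n x / n ≤ c := by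
  obtain ⟨b, hb, hbc⟩ := exists_between hc
  have hneg : ∫ x, (f x - b) ∂μ < 0 := by
    rw [integral_sub hfi (integrable_const _)]
    simpa using hb
  filter_upwards [ae_bddAbove_birkhoffSum_of_integral_neg hT (hf.sub_const b)
    (hfi.sub (integrable_const b)) hneg] with x ⟨M, hM⟩
  have hlim : Tendsto (fun n : ℕ => (M : ℝ) / n) atTop (𝓝 0) :=
    tendsto_const_div_atTop_nhds_zero_nat _
  filter_upwards [hlim.eventually (gt_mem_nhds (sub_pos.2 hbc)), eventually_gt_atTop 0]
    with n hn hn0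
  have h1 : birkhoffSum T (fun x => f x - b) n x = birkhoffSum T f n x - n * b := by
    simp [birkhoffSum, Finset.sum_sub_distrib]
  have h2 := hM n
  rw [h1] at h2
  have hn0' : (0 : ℝ) < n := Nat.cast_pos.2 hn0
  rw [div_lt_iff₀ hn0'] at hn
  rw [div_le_iff₀ hn0']
  nlinarith

/-- The pointwise ergodic theorem. -/
theorem ae_tendsto_birkhoffSum_div [IsProbabilityMeasure μ] (hT : Ergodic T μ)
    (hf : Measurable f) (hfi : Integrable f μ) :
    ∀ᵐ x ∂μ, Tendsto (fun n : ℕ => birkhoffSum T f n x / n) atTop (𝓝 (∫ x, f x ∂μ)) := by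
  have hpos : ∀ k : ℕ, (0 : ℝ) < 1 / ((k : ℝ) + 1) := fun k => Nat.one_div_pos_of_nat
  have h1 : ∀ᵐ x ∂μ, ∀ k : ℕ, ∀ᶠ n : ℕ in atTop,
      birkhoffSum T f n x / n ≤ (∫ x, f x ∂μ) + 1 / ((k : ℝ) + 1) :=
    ae_all_iff.2 fun k => ae_eventually_birkhoffSum_le hT hf hfi (by linarith [hpos k])
  have h2 : ∀ᵐ x ∂μ, ∀ k : ℕ, ∀ᶠ n : ℕ in atTop,
      birkhoffSum T (fun x => -f x) n x / n ≤ (∫ x, -f x ∂μ) + 1 / ((k : ℝ) + 1) :=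
    ae_all_iff.2 fun k => ae_eventually_birkhoffSum_le hT hf.neg hfi.neg
      (lt_add_of_pos_right _ (hpos k))
  filter_upwards [h1, h2] with x hx1 hx2
  rw [Metric.tendsto_atTop']
  intro ε hε
  obtain ⟨k, hk⟩ := exists_nat_one_div_lt hε
  obtain ⟨N, hN⟩ := eventually_atTop.1 ((hx1 k).and (hx2 k))
  refine ⟨N, fun n hn => ?_⟩
  obtain ⟨ha, hb⟩ := hN n hn.le
  have h3 : birkhoffSum T (fun x => -f x) n x = -birkhoffSum T f n x := by
    simp [birkhoffSum]
  rw [h3, integral_neg, neg_div] at hb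
  rw [Real.dist_eq, abs_lt]
  constructor <;> linarith

end BirkhoffErgodic

noncomputable section

/-! ### Conditional probabilities of a letter given its future -/

namespace RandomIFS

variable {m : ℕ}

theorem measurable_shift : Measurable (shift (m := m)) :=
  measurable_pi_lambda _ fun n => measurable_pi_apply (n + 1)

theorem shift_iterate_apply (k : ℕ) (i : Seq m) (n : ℕ) : shift^[k] i n = i (n + k) := by
  induction k generalizing i with
  | zero => rfl
  | succ k ih => rw [Function.iterate_succ_apply, ih]; rfl

/-- The word formed by the first `n` letters of a sequence. -/
def pref (n : ℕ) (i : Seq m) : Fin n → Fin m := fun k => i k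

theorem measurable_pref (n : ℕ) : Measurable (pref (m := m) n) :=
  measurable_pi_lambda _ fun k => measurable_pi_apply (k : ℕ)

theorem mem_wordCylinder {n : ℕ} {w : Fin n → Fin m} {i : Seq m} :
    i ∈ wordCylinder w ↔ pref n i = w := by
  simp [wordCylinder, pref, funext_iff]

theorem wordCylinder_eq_preimage {n : ℕ} (w : Fin n → Fin m) :
    wordCylinder w = pref n ⁻¹' {w} := by
  ext i; exact mem_wordCylinder

theorem measurableSet_wordCylinder {n : ℕ} (w : Fin n → Fin m) :
    MeasurableSet (wordCylinder w) := by
  rw [wordCylinder_eq_preimage]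
  exact measurable_pref n (measurableSet_singleton w)

theorem measurableSet_head_eq (a : Fin m) : MeasurableSet {i : Seq m | i 0 = a} :=
  measurableSet_eq_fun (measurable_pi_apply 0) measurable_const

theorem pref_succ (n : ℕ) (i : Seq m) :
    pref (n + 1) i = Fin.cons (i 0) (pref n (shift i)) := by
  funext k
  refine Fin.cases ?_ (fun k => ?_) k
  · simp [pref]
  · simp [pref, shift]

theorem wordCylinder_cons {n : ℕ} (a : Fin m) (w : Fin n → Fin m) :
    wordCylinder (Fin.cons a w : Fin (n + 1) → Fin m)
      = {i | i 0 = a} ∩ shift ⁻¹' wordCylinder w := by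
  ext i
  simp only [mem_wordCylinder, pref_succ, Set.mem_inter_iff, Set.mem_ofPred_eq, Set.mem_preimage]
  exact Fin.cons_inj

/-- The law of the remaining sequence on the event that the first letter is `a`. -/
def letterMeasure (μ : Measure (Seq m)) (a : Fin m) : Measure (Seq m) :=
  (μ.restrict {i | i 0 = a}).map shift

/-- The conditional probability that the letter preceding `y` is `a`, given the whole sequence `y`:
the density with respect to `μ` of the law of the tail on the event that the first letter is `a`. -/
def letterDensity (μ : Measure (Seq m)) (a : Fin m) : Seq m → ℝ≥0∞ :=
  (letterMeasure μ a).rnDeriv μ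

/-- The conditional probability of the first letter of `i` given all the later ones. -/
def stepDensity (μ : Measure (Seq m)) (i : Seq m) : ℝ≥0∞ :=
  letterDensity μ (i 0) (shift i)

section Stationary

variable {μ : Measure (Seq m)}

theorem measurable_letterDensity (a : Fin m) : Measurable (letterDensity μ a) :=
  Measure.measurable_rnDeriv _ _

theorem measurable_apply_head_shift {β : Type*} [MeasurableSpace β] {u : Fin m → Seq m → β}
    (hu : ∀ a, Measurable (u a)) : Measurable fun i : Seq m => u (i 0) (shift i) := by
  have h : Measurable fun p : Fin m × Seq m => u p.1 p.2 := measurable_from_prod_countable_right hu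
  exact h.comp ((measurable_pi_apply 0).prodMk measurable_shift)

theorem measurable_stepDensity : Measurable (stepDensity μ) :=
  measurable_apply_head_shift fun a => measurable_letterDensity a

theorem letterMeasure_apply (a : Fin m) {s : Set (Seq m)} (hs : MeasurableSet s) :
    letterMeasure μ a s = μ ({i | i 0 = a} ∩ shift ⁻¹' s) := by
  rw [letterMeasure, Measure.map_apply measurable_shift hs,
    Measure.restrict_apply (measurable_shift hs), Set.inter_comm]

theorem letterMeasure_le (hμ : MeasurePreserving shift μ μ) (a : Fin m) :
    letterMeasure μ a ≤ μ := by
  calc letterMeasure μ a ≤ μ.map shift := Measure.map_mono Measure.restrict_le_self measurable_shift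
    _ = μ := hμ.map_eq

variable [IsProbabilityMeasure μ]

instance isFiniteMeasure_letterMeasure (a : Fin m) : IsFiniteMeasure (letterMeasure μ a) := by
  unfold letterMeasure; infer_instance

instance haveLebesgueDecomposition_letterMeasure (a : Fin m) :
    (letterMeasure μ a).HaveLebesgueDecomposition μ :=
  Measure.haveLebesgueDecomposition_of_sigmaFinite _ _

/-- Integration along the decomposition of a sequence into its first letter and its tail. -/
theorem lintegral_head_shift (hμ : MeasurePreserving shift μ μ) {u : Fin m → Seq m → ℝ≥0∞}
    (hu : ∀ a, Measurable (u a)) :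
    ∫⁻ i, u (i 0) (shift i) ∂μ = ∑ a, ∫⁻ y, letterDensity μ a y * u a y ∂μ := by
  have h1 : ∀ a, ∫⁻ y, letterDensity μ a y * u a y ∂μ
      = ∫⁻ i, Set.indicator {i : Seq m | i 0 = a} (fun i => u a (shift i)) i ∂μ := by
    intro a
    rw [letterDensity, lintegral_rnDeriv_mul
      (Measure.absolutelyContinuous_of_le (letterMeasure_le hμ a)) (hu a).aemeasurable,
      letterMeasure, lintegral_map (hu a) measurable_shift,
      lintegral_indicator (measurableSet_head_eq a)]
  simp_rw [h1]
  rw [← lintegral_finsetSum]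
  · refine lintegral_congr fun i => ?_
    rw [Finset.sum_eq_single (i 0)]
    · simp
    · intro b _ hb
      exact Set.indicator_of_notMem (s := {i : Seq m | i 0 = b}) (fun h => hb (Eq.symm h)) _
    · simp
  · exact fun a _ => ((hu a).comp measurable_shift).indicator (measurableSet_head_eq a)

theorem ae_head_shift (hμ : MeasurePreserving shift μ μ) {p : Fin m → Seq m → Prop}
    (hp : ∀ a, MeasurableSet {y | p a y})
    (h : ∀ a, ∀ᵐ y ∂μ, letterDensity μ a y ≠ 0 → p a y) : ∀ᵐ i ∂μ, p (i 0) (shift i) := by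
  have h0 : ∫⁻ i, Set.indicator {y | p (i 0) y}ᶜ (fun _ => (1 : ℝ≥0∞)) (shift i) ∂μ = 0 := by
    rw [lintegral_head_shift hμ
      (u := fun a => Set.indicator {y | p a y}ᶜ (fun _ => (1 : ℝ≥0∞)))
      fun a => measurable_const.indicator (hp a).compl]
    refine Finset.sum_eq_zero fun a _ => ?_
    refine (lintegral_eq_zero_iff ((measurable_letterDensity a).mul
      (measurable_const.indicator (hp a).compl))).2 ?_
    filter_upwards [h a] with y hy
    by_cases hy0 : letterDensity μ a y = 0
    · simp [hy0]
    · simp [hy hy0]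
  rw [lintegral_eq_zero_iff (measurable_apply_head_shift
    (u := fun a => Set.indicator {y | p a y}ᶜ (fun _ => (1 : ℝ≥0∞)))
      fun a => measurable_const.indicator (hp a).compl)] at h0
  filter_upwards [h0] with i hi
  by_contra hn
  simp [hn] at hi

theorem ae_letterDensity_le_one (hμ : MeasurePreserving shift μ μ) (a : Fin m) :
    ∀ᵐ y ∂μ, letterDensity μ a y ≤ 1 :=
  Measure.rnDeriv_le_one_of_le (letterMeasure_le hμ a)

theorem ae_stepDensity_mem (hμ : MeasurePreserving shift μ μ) :
    ∀ᵐ i ∂μ, ∀ k : ℕ, stepDensity μ (shift^[k] i) ≠ 0 ∧ stepDensity μ (shift^[k] i) ≤ 1 := by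
  have h0 : ∀ᵐ i ∂μ, stepDensity μ i ≠ 0 ∧ stepDensity μ i ≤ 1 := by
    refine ae_head_shift hμ (p := fun a y => letterDensity μ a y ≠ 0 ∧ letterDensity μ a y ≤ 1)
      (fun a => ?_) fun a => ?_
    · exact (measurable_letterDensity a (measurableSet_singleton 0).compl).inter
        (measurableSet_le (measurable_letterDensity a) measurable_const)
    · filter_upwards [ae_letterDensity_le_one hμ a] with y hy h0 using ⟨h0, hy⟩
  exact ae_all_iff.2 fun k => (hμ.iterate k).quasiMeasurePreserving.ae h0

/-- The product of the conditional probabilities of the successive letters given their futures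
charges words at least as much as any weight `c` of finite mass does, on average. -/
theorem lintegral_prefix_mul_prod_inv_le (hμ : MeasurePreserving shift μ μ) (n : ℕ)
    (c : (Fin n → Fin m) → ℝ≥0∞) :
    ∫⁻ i, c (pref n i) * ∏ k ∈ Finset.range n, (stepDensity μ (shift^[k] i))⁻¹ ∂μ
      ≤ ∑ w, c w := by
  induction n with
  | zero =>
    have : ∀ i : Seq m, pref 0 i = default := fun i => Subsingleton.elim _ _
    simp [this]
  | succ n ih =>
    set V : Fin m → Seq m → ℝ≥0∞ := fun a y =>
      c (Fin.cons a (pref n y)) * ∏ k ∈ Finset.range n, (stepDensity μ (shift^[k] y))⁻¹ with hV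
    have hVm : ∀ a, Measurable (V a) := by
      intro a
      refine Measurable.mul ?_ (Finset.measurable_prod _ fun k _ => ?_)
      · exact (Measurable.of_discrete (f := fun w : Fin n → Fin m =>
          c (Fin.cons a w : Fin (n + 1) → Fin m))).comp (measurable_pref n)
      · exact (measurable_stepDensity.comp (measurable_shift.iterate k)).inv
    calc ∫⁻ i, c (pref (n + 1) i)
          * ∏ k ∈ Finset.range (n + 1), (stepDensity μ (shift^[k] i))⁻¹ ∂μ
        = ∫⁻ i, (letterDensity μ (i 0) (shift i))⁻¹ * V (i 0) (shift i) ∂μ := by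
          refine lintegral_congr fun i => ?_
          rw [Finset.prod_range_succ', pref_succ, hV]
          simp only [Function.iterate_succ_apply, Function.iterate_zero, id_eq, stepDensity]
          ring
      _ = ∑ a, ∫⁻ y, letterDensity μ a y * ((letterDensity μ a y)⁻¹ * V a y) ∂μ :=
          lintegral_head_shift hμ (u := fun a y => (letterDensity μ a y)⁻¹ * V a y)
            fun a => (measurable_letterDensity a).inv.mul (hVm a)
      _ ≤ ∑ a, ∫⁻ y, V a y ∂μ := by
          gcongr with a _ y
          rw [← mul_assoc]
          exact mul_le_of_le_one_left' (ENNReal.mul_inv_le_one _)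
      _ ≤ ∑ a, ∑ w : Fin n → Fin m, c (Fin.cons a w) := by
          gcongr with a _
          exact ih fun w => c (Fin.cons a w)
      _ = ∑ w, c w := by
          rw [← Fintype.sum_prod_type', ← (Fin.consEquiv fun _ : Fin (n + 1) => Fin m).sum_comp]
          rfl

theorem sum_measure_wordCylinder (n : ℕ) : ∑ w : Fin n → Fin m, μ (wordCylinder w) = 1 := by
  simp_rw [wordCylinder_eq_preimage]
  rw [sum_measure_preimage_singleton _ fun w _ => measurable_pref n (measurableSet_singleton w)]
  simp

/-- Almost surely, the mass of the `n`-th cylinder is at most `(n + 1)²` times the product of the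
conditional probabilities of the letters given their futures, for all large `n`. -/
theorem ae_eventually_measure_cylinder_le (hμ : MeasurePreserving shift μ μ) :
    ∀ᵐ i ∂μ, ∀ᶠ n : ℕ in atTop, μ (wordCylinder (pref n i))
        * ∏ k ∈ Finset.range n, (stepDensity μ (shift^[k] i))⁻¹ ≤ ((n : ℝ≥0∞) + 1) ^ 2 := by
  set F : ℕ → Seq m → ℝ≥0∞ := fun n i => μ (wordCylinder (pref n i))
        * ∏ k ∈ Finset.range n, (stepDensity μ (shift^[k] i))⁻¹ with hF
  have hFm : ∀ n, Measurable (F n) := by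
    intro n
    refine Measurable.mul ?_ (Finset.measurable_prod _ fun k _ => ?_)
    · exact (Measurable.of_discrete (f := fun w : Fin n → Fin m =>
          μ (wordCylinder w))).comp (measurable_pref n)
    · exact (measurable_stepDensity.comp (measurable_shift.iterate k)).inv
  have hFi : ∀ n, ∫⁻ i, F n i ∂μ ≤ 1 := fun n =>
    (lintegral_prefix_mul_prod_inv_le hμ n fun w => μ (wordCylinder w)).trans_eq
      (sum_measure_wordCylinder n)
  have hs : ∑' n : ℕ, (((n : ℝ≥0∞) + 1) ^ 2)⁻¹ ≠ ∞ := by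
    have h1 : Summable fun n : ℕ => ((((n : ℝ) + 1) ^ 2)⁻¹) := by
      have := (summable_nat_add_iff 1).2 (Real.summable_nat_pow_inv.2 one_lt_two)
      simpa using this
    have h2 : ∀ n : ℕ, (((n : ℝ≥0∞) + 1) ^ 2)⁻¹ = ENNReal.ofReal ((((n : ℝ) + 1) ^ 2)⁻¹) := by
      intro n
      rw [ENNReal.ofReal_inv_of_pos (by positivity), ENNReal.ofReal_pow (by positivity),
        ENNReal.ofReal_add (by positivity) zero_le_one]
      simp
    simp_rw [h2]
    exact h1.tsum_ofReal_ne_top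
  have hI : ∫⁻ i, ∑' n : ℕ, (((n : ℝ≥0∞) + 1) ^ 2)⁻¹ * F n i ∂μ ≠ ∞ := by
    rw [lintegral_tsum fun n => ((hFm n).const_mul _).aemeasurable]
    refine ne_top_of_le_ne_top hs (ENNReal.tsum_le_tsum fun n => ?_)
    rw [lintegral_const_mul _ (hFm n)]
    exact mul_le_of_le_one_right' (hFi n)
  filter_upwards [ae_lt_top (Measurable.tsum fun n => (hFm n).const_mul _) hI] with i hi
  have ht := ENNReal.tendsto_atTop_zero_of_tsum_ne_top hi.ne
  filter_upwards [ht.eventually (ge_mem_nhds zero_lt_one)] with n hn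
  rw [mul_comm, ← div_eq_mul_inv] at hn
  rw [ENNReal.div_le_iff (by positivity) (by finiteness)] at hn
  simpa using hn

end Stationary

end RandomIFS

/-! ### The entropy rate and the lower Shannon–McMillan–Breiman bound -/

namespace RandomIFS

variable {m : ℕ}

/-- The filtration generated by the successive letters: at time `n` the first `n` letters are
known. -/
def prefixFiltration (m : ℕ) : Filtration ℕ (MeasurableSpace.pi : MeasurableSpace (Seq m)) where
  seq n := MeasurableSpace.comap (pref n) inferInstance
  mono' n n' h := by
    change MeasurableSpace.comap (pref n) _ ≤ MeasurableSpace.comap (pref n') _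
    have h1 : pref (m := m) n = (fun w (k : Fin n) => w (Fin.castLE h k)) ∘ pref n' := rfl
    rw [h1, ← MeasurableSpace.comap_comp]
    exact MeasurableSpace.comap_mono (Measurable.of_discrete.comap_le)
  le' n := (measurable_pref n).comap_le

theorem iSup_prefixFiltration (m : ℕ) :
    ⨆ n, prefixFiltration m n = (MeasurableSpace.pi : MeasurableSpace (Seq m)) := by
  refine le_antisymm (iSup_le fun n => (prefixFiltration m).le n) (iSup_le fun k => ?_)
  refine le_trans ?_ (le_iSup _ (k + 1))
  have h1 : (fun i : Seq m => i k) = (fun w => w (Fin.last k)) ∘ pref (k + 1) := rfl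
  rw [h1, ← MeasurableSpace.comap_comp]
  exact MeasurableSpace.comap_mono (measurable_pi_apply _).comap_le

theorem measurable_comp_pref {β : Type*} [MeasurableSpace β] {n : ℕ} (F : (Fin n → Fin m) → β) :
    Measurable fun i : Seq m => F (pref n i) :=
  Measurable.of_discrete.comp (measurable_pref n)

variable {μ : Measure (Seq m)} [IsProbabilityMeasure μ]

theorem integral_comp_pref {n : ℕ} (F : (Fin n → Fin m) → ℝ) :
    ∫ i, F (pref n i) ∂μ = ∑ w, μ.real (wordCylinder w) * F w := by
  rw [← integral_map (f := F) (measurable_pref n).aemeasurable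
    Measurable.of_discrete.aestronglyMeasurable]
  have := Measure.isProbabilityMeasure_map (μ := μ) (measurable_pref n).aemeasurable
  rw [integral_fintype (Integrable.of_finite)]
  refine Finset.sum_congr rfl fun w _ => ?_
  rw [map_measureReal_apply (measurable_pref n) (measurableSet_singleton w),
    wordCylinder_eq_preimage, smul_eq_mul]

theorem ae_measureReal_cylinder_pos :
    ∀ᵐ i ∂μ, ∀ n, 0 < μ.real (wordCylinder (pref n i)) := by
  refine ae_all_iff.2 fun n => ?_
  have h : ∀ᵐ i ∂μ, ∀ w : Fin n → Fin m, μ (wordCylinder w) = 0 → i ∉ wordCylinder w := by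
    refine ae_all_iff.2 fun w => ?_
    by_cases hw : μ (wordCylinder w) = 0
    · filter_upwards [measure_eq_zero_iff_ae_notMem.1 hw] with i hi _ using hi
    · exact ae_of_all _ fun i h => absurd h hw
  filter_upwards [h] with i hi
  refine measureReal_nonneg.lt_of_ne fun h0 => ?_
  exact hi (pref n i) ((measureReal_eq_zero_iff).1 h0.symm) (mem_wordCylinder.2 rfl)

/-- The entropy of the first letter given its whole future. -/
def condEntropy (μ : Measure (Seq m)) : ℝ :=
  ∑ a, ∫ y, Real.negMulLog (letterDensity μ a y).toReal ∂μ

/-- The conditional expectation of `letterDensity` given the first `n` letters is the quotient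
`μ[a y₁ … yₙ] / μ[y₁ … yₙ]`. -/
theorem condExp_letterDensity_mul (hμ : MeasurePreserving shift μ μ) (a : Fin m) (n : ℕ)
    (y : Seq m) :
    μ.real (wordCylinder (pref n y))
        * (μ[fun y => (letterDensity μ a y).toReal | prefixFiltration m n]) y
      = μ.real (wordCylinder (Fin.cons a (pref n y) : Fin (n + 1) → Fin m)) := by
  set f : Seq m → ℝ := fun y => (letterDensity μ a y).toReal with hf
  set r := μ[f | prefixFiltration m n] with hr
  have hS : MeasurableSet[prefixFiltration m n] (wordCylinder (pref n y)) :=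
    ⟨{pref n y}, measurableSet_singleton _, (wordCylinder_eq_preimage _).symm⟩
  -- a function of the first `n` letters is constant on cylinders
  have hconst : ∀ x ∈ wordCylinder (pref n y), r x = r y := by
    intro x hx
    have hm : Measurable[prefixFiltration m n] r := stronglyMeasurable_condExp.measurable
    obtain ⟨S, -, hS⟩ := hm (measurableSet_singleton (r y))
    have h1 : y ∈ pref n ⁻¹' S := by rw [hS]; rfl
    have h2 : x ∈ pref n ⁻¹' S := by
      rw [Set.mem_preimage, mem_wordCylinder.1 hx]; exact h1
    rw [hS] at h2
    exact h2
  have hint : Integrable f μ := Measure.integrable_toReal_rnDeriv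
  have h1 : ∫ x in wordCylinder (pref n y), r x ∂μ = ∫ x in wordCylinder (pref n y), f x ∂μ :=
    setIntegral_condExp ((prefixFiltration m).le n) hint hS
  have h2 : ∫ x in wordCylinder (pref n y), r x ∂μ = μ.real (wordCylinder (pref n y)) * r y := by
    rw [setIntegral_congr_fun (measurableSet_wordCylinder _) hconst]
    simp
  have h3 : ∫ x in wordCylinder (pref n y), f x ∂μ
      = (letterMeasure μ a).real (wordCylinder (pref n y)) :=
    Measure.setIntegral_toReal_rnDeriv
      (Measure.absolutelyContinuous_of_le (letterMeasure_le hμ a)) _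
  rw [← h2, h1, h3, wordCylinder_cons, Measure.real,
    letterMeasure_apply a (measurableSet_wordCylinder _)]
  rfl

theorem sum_measureReal_cons (hμ : MeasurePreserving shift μ μ) {n : ℕ} (w : Fin n → Fin m) :
    ∑ a, μ.real (wordCylinder (Fin.cons a w : Fin (n + 1) → Fin m)) = μ.real (wordCylinder w) := by
  rw [← hμ.measureReal_preimage (measurableSet_wordCylinder w).nullMeasurableSet]
  have : shift ⁻¹' wordCylinder w
      = ⋃ a ∈ (Finset.univ : Finset (Fin m)),
        wordCylinder (Fin.cons a w : Fin (n + 1) → Fin m) := by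
    ext i; simp [wordCylinder_cons]
  rw [this, measureReal_biUnion_finset]
  · intro a _ b _ hab
    refine Set.disjoint_left.2 fun i hi hi' => hab ?_
    simp only [wordCylinder_cons] at hi hi'
    exact hi.1.symm.trans hi'.1
  · exact fun a _ => measurableSet_wordCylinder _

/-- The chain rule: the increment of the block entropies is the entropy of a letter given the
`n` letters that follow it. -/
theorem blockEntropy_succ_sub (hμ : MeasurePreserving shift μ μ) (n : ℕ) :
    blockEntropy μ (n + 1) - blockEntropy μ n
      = ∑ a, ∫ y, Real.negMulLog
        (μ.real (wordCylinder (Fin.cons a (pref n y) : Fin (n + 1) → Fin m))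
          / μ.real (wordCylinder (pref n y))) ∂μ := by
  have h1 : ∀ a, ∫ y, Real.negMulLog
        (μ.real (wordCylinder (Fin.cons a (pref n y) : Fin (n + 1) → Fin m))
          / μ.real (wordCylinder (pref n y))) ∂μ
      = ∑ w : Fin n → Fin m, μ.real (wordCylinder w) * Real.negMulLog
        (μ.real (wordCylinder (Fin.cons a w : Fin (n + 1) → Fin m)) / μ.real (wordCylinder w)) :=
    fun a => integral_comp_pref fun w => Real.negMulLog
        (μ.real (wordCylinder (Fin.cons a w : Fin (n + 1) → Fin m)) / μ.real (wordCylinder w))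
  simp_rw [h1]
  have h2 : ∀ (a : Fin m) (w : Fin n → Fin m), μ.real (wordCylinder w) * Real.negMulLog
        (μ.real (wordCylinder (Fin.cons a w : Fin (n + 1) → Fin m)) / μ.real (wordCylinder w))
      = Real.negMulLog (μ.real (wordCylinder (Fin.cons a w : Fin (n + 1) → Fin m)))
        + μ.real (wordCylinder (Fin.cons a w : Fin (n + 1) → Fin m))
          * Real.log (μ.real (wordCylinder w)) := by
    intro a w
    set q := μ.real (wordCylinder (Fin.cons a w : Fin (n + 1) → Fin m)) with hq
    set p := μ.real (wordCylinder w) with hp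
    have hqp : q ≤ p := by
      rw [hp, ← sum_measureReal_cons hμ w]
      exact Finset.single_le_sum (f := fun a =>
        μ.real (wordCylinder (Fin.cons a w : Fin (n + 1) → Fin m)))
        (fun _ _ => measureReal_nonneg) (Finset.mem_univ a)
    rcases (show 0 ≤ q from measureReal_nonneg).eq_or_lt with h0 | h0
    · rw [← h0]; simp
    · have hp0 : 0 < p := h0.trans_le hqp
      rw [Real.negMulLog, Real.negMulLog, Real.log_div h0.ne' hp0.ne']
      field_simp
      ring
  simp_rw [h2, Finset.sum_add_distrib]
  rw [Finset.sum_comm (f := fun (a : Fin m) (w : Fin n → Fin m) =>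
    μ.real (wordCylinder (Fin.cons a w : Fin (n + 1) → Fin m)) * Real.log (μ.real (wordCylinder w)))]
  simp_rw [← Finset.sum_mul, sum_measureReal_cons hμ]
  have h3 : blockEntropy μ (n + 1) = ∑ a, ∑ w : Fin n → Fin m,
      Real.negMulLog (μ.real (wordCylinder (Fin.cons a w : Fin (n + 1) → Fin m))) := by
    rw [blockEntropy, ← Fintype.sum_prod_type',
      ← (Fin.consEquiv fun _ : Fin (n + 1) => Fin m).sum_comp]
    rfl
  have h4 : ∑ w : Fin n → Fin m, μ.real (wordCylinder w) * Real.log (μ.real (wordCylinder w))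
      = -blockEntropy μ n := by
    rw [blockEntropy, ← Finset.sum_neg_distrib]
    simp [Real.negMulLog]
  rw [h3, h4, sub_eq_add_neg]

/-- Lévy's upward theorem turns the increments of the block entropies into the entropy of a letter
given its whole future. -/
theorem tendsto_blockEntropy_succ_sub (hμ : MeasurePreserving shift μ μ) :
    Tendsto (fun n => blockEntropy μ (n + 1) - blockEntropy μ n) atTop (𝓝 (condEntropy μ)) := by
  simp_rw [blockEntropy_succ_sub hμ]
  refine tendsto_finsetSum _ fun a _ => ?_
  refine tendsto_integral_of_dominated_convergence (fun _ => (1 : ℝ)) (fun n => ?_)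
    (integrable_const _) (fun n => ?_) ?_
  · exact (measurable_comp_pref fun w : Fin n → Fin m => Real.negMulLog
      (μ.real (wordCylinder (Fin.cons a w : Fin (n + 1) → Fin m))
        / μ.real (wordCylinder w))).aestronglyMeasurable
  · refine ae_of_all _ fun y => ?_
    have hle : μ.real (wordCylinder (Fin.cons a (pref n y) : Fin (n + 1) → Fin m))
        ≤ μ.real (wordCylinder (pref n y)) := by
      rw [← sum_measureReal_cons hμ (pref n y)]
      exact Finset.single_le_sum (f := fun a =>
        μ.real (wordCylinder (Fin.cons a (pref n y) : Fin (n + 1) → Fin m)))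
        (fun _ _ => measureReal_nonneg) (Finset.mem_univ a)
    have h0 : 0 ≤ μ.real (wordCylinder (Fin.cons a (pref n y) : Fin (n + 1) → Fin m))
        / μ.real (wordCylinder (pref n y)) := by positivity
    have h1 : μ.real (wordCylinder (Fin.cons a (pref n y) : Fin (n + 1) → Fin m))
        / μ.real (wordCylinder (pref n y)) ≤ 1 := div_le_one_of_le₀ hle measureReal_nonneg
    rw [Real.norm_of_nonneg (Real.negMulLog_nonneg h0 h1)]
    exact (Real.negMulLog_le_one_sub_self h0).trans (by linarith)
  · have hint : Integrable (fun y => (letterDensity μ a y).toReal) μ :=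
      Measure.integrable_toReal_rnDeriv
    have hmeas : StronglyMeasurable[⨆ n, prefixFiltration m n]
        (fun y => (letterDensity μ a y).toReal) := by
      rw [iSup_prefixFiltration]
      exact (measurable_letterDensity a).ennreal_toReal.stronglyMeasurable
    filter_upwards [hint.tendsto_ae_condExp hmeas, ae_measureReal_cylinder_pos (μ := μ)]
      with y hy hpos
    refine (Real.continuous_negMulLog.tendsto _).comp (hy.congr fun n => ?_)
    rw [eq_div_iff (hpos n).ne', mul_comm]
    exact condExp_letterDensity_mul hμ a n y

theorem tendsto_blockEntropy_div (hμ : MeasurePreserving shift μ μ) :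
    Tendsto (fun n : ℕ => blockEntropy μ n / n) atTop (𝓝 (condEntropy μ)) := by
  refine (tendsto_blockEntropy_succ_sub hμ).cesaro.congr fun n => ?_
  have h0 : blockEntropy μ 0 = 0 := by
    have : ∀ w : Fin 0 → Fin m, wordCylinder w = Set.univ := fun w => by
      ext i; simp [wordCylinder]
    simp [blockEntropy, this]
  rw [Finset.sum_range_sub, h0, sub_zero, inv_mul_eq_div]

/-- The increments of the block entropies converge, so their averages `Hₙ / n` have the same
limit. -/
theorem entropy_eq_condEntropy (hμ : MeasurePreserving shift μ μ) :
    entropy μ = condEntropy μ :=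
  (tendsto_blockEntropy_div hμ).limsup_eq

theorem tendsto_blockEntropy_div_entropy (hμ : MeasurePreserving shift μ μ) :
    Tendsto (fun n : ℕ => blockEntropy μ n / n) atTop (𝓝 (entropy μ)) := by
  rw [entropy_eq_condEntropy hμ]
  exact tendsto_blockEntropy_div hμ

theorem entropy_nonneg (hμ : MeasurePreserving shift μ μ) : 0 ≤ entropy μ :=
  ge_of_tendsto' (tendsto_blockEntropy_div_entropy hμ) fun n => div_nonneg
    (Finset.sum_nonneg fun _ _ => Real.negMulLog_nonneg measureReal_nonneg measureReal_le_one)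
    n.cast_nonneg

/-- The information carried by the first letter given its whole future. -/
def stepInformation (μ : Measure (Seq m)) (i : Seq m) : ℝ :=
  -Real.log (stepDensity μ i).toReal

theorem measurable_stepInformation (μ : Measure (Seq m)) : Measurable (stepInformation μ) :=
  (Real.measurable_log.comp measurable_stepDensity.ennreal_toReal).neg

theorem ae_stepInformation_nonneg (hμ : MeasurePreserving shift μ μ) :
    ∀ᵐ i ∂μ, 0 ≤ stepInformation μ i := by
  filter_upwards [ae_stepDensity_mem hμ] with i hi
  have h1 : stepDensity μ i ≤ 1 := (hi 0).2
  refine neg_nonneg.2 (Real.log_nonpos ENNReal.toReal_nonneg ?_)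
  simpa using ENNReal.toReal_mono ENNReal.one_ne_top h1

theorem lintegral_ofReal_stepInformation (hμ : MeasurePreserving shift μ μ) :
    ∫⁻ i, ENNReal.ofReal (stepInformation μ i) ∂μ = ENNReal.ofReal (condEntropy μ) := by
  have h1 : ∫⁻ i, ENNReal.ofReal (stepInformation μ i) ∂μ
      = ∑ a, ∫⁻ y, letterDensity μ a y
        * ENNReal.ofReal (-Real.log (letterDensity μ a y).toReal) ∂μ :=
    lintegral_head_shift hμ (u := fun a y => ENNReal.ofReal (-Real.log (letterDensity μ a y).toReal))
      fun a => (Real.measurable_log.comp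
        (measurable_letterDensity a).ennreal_toReal).neg.ennreal_ofReal
  have hmem : ∀ a, ∀ᵐ y ∂μ, 0 ≤ (letterDensity μ a y).toReal ∧ (letterDensity μ a y).toReal ≤ 1 := by
    intro a
    filter_upwards [ae_letterDensity_le_one hμ a] with y hy
    exact ⟨ENNReal.toReal_nonneg, by simpa using ENNReal.toReal_mono ENNReal.one_ne_top hy⟩
  have hnn : ∀ a, 0 ≤ᵐ[μ] fun y => Real.negMulLog (letterDensity μ a y).toReal := fun a => by
    filter_upwards [hmem a] with y hy using Real.negMulLog_nonneg hy.1 hy.2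
  have hint : ∀ a, Integrable (fun y => Real.negMulLog (letterDensity μ a y).toReal) μ := fun a => by
    refine Integrable.of_bound (C := 1) (Real.continuous_negMulLog.measurable.comp
      (measurable_letterDensity a).ennreal_toReal).aestronglyMeasurable ?_
    filter_upwards [hmem a] with y hy
    rw [Real.norm_of_nonneg (Real.negMulLog_nonneg hy.1 hy.2)]
    exact (Real.negMulLog_le_one_sub_self hy.1).trans (by linarith [hy.1])
  rw [h1, condEntropy, ENNReal.ofReal_sum_of_nonneg fun a _ => integral_nonneg_of_ae (hnn a)]
  refine Finset.sum_congr rfl fun a _ => ?_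
  rw [ofReal_integral_eq_lintegral_ofReal (hint a) (hnn a)]
  refine lintegral_congr_ae ?_
  filter_upwards [ae_letterDensity_le_one hμ a] with y hy
  have hfin : letterDensity μ a y ≠ ∞ := ne_top_of_le_ne_top ENNReal.one_ne_top hy
  rw [Real.negMulLog, neg_mul, ← mul_neg, ENNReal.ofReal_mul ENNReal.toReal_nonneg,
    ENNReal.ofReal_toReal hfin]

theorem integrable_stepInformation (hμ : MeasurePreserving shift μ μ) :
    Integrable (stepInformation μ) μ := by
  refine (lintegral_ofReal_ne_top_iff_integrable (measurable_stepInformation μ).aestronglyMeasurable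
    (ae_stepInformation_nonneg hμ)).1 ?_
  rw [lintegral_ofReal_stepInformation hμ]
  exact ENNReal.ofReal_ne_top

theorem integral_stepInformation (hμ : MeasurePreserving shift μ μ) :
    ∫ i, stepInformation μ i ∂μ = entropy μ := by
  rw [integral_eq_lintegral_of_nonneg_ae (ae_stepInformation_nonneg hμ)
    (measurable_stepInformation μ).aestronglyMeasurable, lintegral_ofReal_stepInformation hμ,
    ← entropy_eq_condEntropy hμ, ENNReal.toReal_ofReal (entropy_nonneg hμ)]

/-- The lower half of the Shannon–McMillan–Breiman theorem. -/
theorem ae_eventually_measureReal_cylinder_le (hμ : Ergodic (shift (m := m)) μ) :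
    ∀ᵐ i ∂μ, ∀ ε > 0, ∀ᶠ n : ℕ in atTop,
      μ.real (wordCylinder (pref n i)) ≤ Real.exp (-(n * (entropy μ - ε))) := by
  have hμ' := hμ.toMeasurePreserving
  filter_upwards [ae_eventually_measure_cylinder_le hμ', ae_stepDensity_mem hμ',
    ae_measureReal_cylinder_pos (μ := μ), ae_tendsto_birkhoffSum_div hμ (measurable_stepInformation μ)
      (integrable_stepInformation hμ')] with i h1 h2 hpos h3 ε hε
  rw [integral_stepInformation hμ'] at h3
  have hlog : Tendsto (fun n : ℕ => 2 * Real.log ((n : ℝ) + 1) / n) atTop (𝓝 0) := by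
    have ha : Tendsto (fun x : ℝ => Real.log x / x) atTop (𝓝 0) := by
      simpa using Real.isLittleO_log_id_atTop.tendsto_div_nhds_zero
    have hb : Tendsto (fun n : ℕ => (n : ℝ) + 1) atTop atTop :=
      tendsto_atTop_add_const_right _ _ tendsto_natCast_atTop_atTop
    have hc : Tendsto (fun n : ℕ => ((n : ℝ) + 1) / n) atTop (𝓝 1) := by
      have : Tendsto (fun n : ℕ => (1 : ℝ) + 1 / n) atTop (𝓝 (1 + 0)) :=
        tendsto_const_nhds.add tendsto_one_div_atTop_nhds_zero_nat
      rw [add_zero] at this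
      refine this.congr' ?_
      filter_upwards [eventually_gt_atTop 0] with n hn
      have : (n : ℝ) ≠ 0 := by positivity
      field_simp
    have hd := ((ha.comp hb).mul hc).const_mul 2
    simp only [zero_mul, mul_zero] at hd
    refine hd.congr fun n => ?_
    have : (n : ℝ) + 1 ≠ 0 := by positivity
    simp only [Function.comp]
    field_simp
  filter_upwards [h1, h3.eventually (lt_mem_nhds (show entropy μ - ε / 2 < entropy μ by linarith)),
    hlog.eventually (gt_mem_nhds (half_pos hε)), eventually_gt_atTop 0] with n hn1 hn2 hn3 hn0
  have hn0' : (0 : ℝ) < n := Nat.cast_pos.2 hn0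
  rw [lt_div_iff₀ hn0'] at hn2
  rw [div_lt_iff₀ hn0'] at hn3
  have hG : ∀ k, 0 < (stepDensity μ (shift^[k] i)).toReal := fun k =>
    ENNReal.toReal_pos (h2 k).1 (ne_top_of_le_ne_top ENNReal.one_ne_top (h2 k).2)
  have hn4 := ENNReal.toReal_mono (by finiteness) hn1
  rw [ENNReal.toReal_mul, ENNReal.toReal_prod, ENNReal.toReal_pow,
    ENNReal.toReal_add (by finiteness) (by finiteness)] at hn4
  simp only [ENNReal.toReal_inv, ENNReal.toReal_natCast, ENNReal.toReal_one] at hn4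
  change μ.real (wordCylinder (pref n i)) * _ ≤ _ at hn4
  have hprod : 0 < ∏ k ∈ Finset.range n, (stepDensity μ (shift^[k] i)).toReal⁻¹ :=
    Finset.prod_pos fun k _ => inv_pos.2 (hG k)
  have hn5 := Real.log_le_log (mul_pos (hpos n) hprod) hn4
  rw [Real.log_mul (hpos n).ne' hprod.ne', Real.log_prod (fun k _ => (inv_pos.2 (hG k)).ne'),
    Real.log_pow] at hn5
  have hsum : ∑ k ∈ Finset.range n, Real.log (stepDensity μ (shift^[k] i)).toReal⁻¹
      = birkhoffSum shift (stepInformation μ) n i :=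
    Finset.sum_congr rfl fun k _ => Real.log_inv _
  rw [hsum] at hn5
  rw [← Real.log_le_iff_le_exp (hpos n)]
  push_cast at hn5
  linarith

end RandomIFS

/-! ### Convergence of the information along a subsequence, and typical sequences -/

namespace RandomIFS

variable {m : ℕ}

/-- Convergence in `L¹`, hence almost surely along a subsequence, in the Shannon–McMillan–Breiman
theorem: the lower half controls the negative part of `-log μ[i₁ … iₙ] / n - h(μ)`, and the means
converge to `h(μ)`. -/
theorem exists_subseq_ae_tendsto_information {μ : Measure (Seq m)} [IsProbabilityMeasure μ]
    (hμ : Ergodic (shift (m := m)) μ) :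
    ∃ ns : ℕ → ℕ, StrictMono ns ∧ ∀ᵐ i ∂μ, Tendsto (fun k =>
      -Real.log (μ.real (wordCylinder (pref (ns k) i))) / (ns k : ℝ)) atTop (𝓝 (entropy μ)) := by
  have hμ' := hμ.toMeasurePreserving
  set h := entropy μ with hh
  set f : ℕ → Seq m → ℝ := fun n i => -Real.log (μ.real (wordCylinder (pref n i))) / (n : ℝ) with hf
  have hfm : ∀ n, Measurable (f n) := fun n =>
    measurable_comp_pref fun w : Fin n → Fin m => -Real.log (μ.real (wordCylinder w)) / (n : ℝ)
  have hfi : ∀ n, Integrable (f n) μ := by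
    intro n
    refine Integrable.of_bound
      (C := ∑ w : Fin n → Fin m, ‖-Real.log (μ.real (wordCylinder w)) / (n : ℝ)‖)
      (hfm n).aestronglyMeasurable (ae_of_all _ fun i => ?_)
    exact Finset.single_le_sum
      (f := fun w : Fin n → Fin m => ‖-Real.log (μ.real (wordCylinder w)) / (n : ℝ)‖)
      (fun _ _ => norm_nonneg _) (Finset.mem_univ (pref n i))
  have hf0 : ∀ n i, 0 ≤ f n i := fun n i => div_nonneg
    (neg_nonneg.2 (Real.log_nonpos measureReal_nonneg measureReal_le_one)) n.cast_nonneg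
  have hmean : ∀ n, ∫ i, f n i ∂μ = blockEntropy μ n / n := by
    intro n
    rw [hf, integral_comp_pref fun w : Fin n → Fin m =>
      -Real.log (μ.real (wordCylinder w)) / (n : ℝ), blockEntropy, Finset.sum_div]
    refine Finset.sum_congr rfl fun w _ => ?_
    rw [Real.negMulLog]
    ring
  have hdef : Tendsto (fun n => ∫ i, max (h - f n i) 0 ∂μ) atTop (𝓝 0) := by
    suffices key : Tendsto (fun n => ∫ i, max (h - f n i) 0 ∂μ) atTop
        (𝓝 (∫ _ : Seq m, (0 : ℝ) ∂μ)) by simpa using key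
    refine tendsto_integral_of_dominated_convergence (fun _ => h)
      (fun n => ((measurable_const.sub (hfm n)).max measurable_const).aestronglyMeasurable)
      (integrable_const _) (fun n => ae_of_all _ fun i => ?_) ?_
    · rw [Real.norm_of_nonneg (le_max_right _ _)]
      exact max_le (by linarith [hf0 n i]) (entropy_nonneg hμ')
    · filter_upwards [ae_eventually_measureReal_cylinder_le hμ, ae_measureReal_cylinder_pos (μ := μ)]
        with i hi hpos
      rw [Metric.tendsto_atTop']
      intro ε hε
      obtain ⟨N, hN⟩ := eventually_atTop.1 (hi (ε / 2) (half_pos hε))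
      refine ⟨N, fun n hn => ?_⟩
      have hn0 : (0 : ℝ) < n := Nat.cast_pos.2 (by omega)
      have h1 := hN n hn.le
      rw [← Real.log_le_iff_le_exp (hpos n)] at h1
      have h2 : h - ε / 2 ≤ f n i := by
        rw [hf, le_div_iff₀ hn0]
        linarith
      rw [Real.dist_eq, sub_zero, abs_of_nonneg (le_max_right _ _)]
      exact max_lt (by linarith) hε
  have hL1 : Tendsto (fun n => ∫ i, ‖f n i - h‖ ∂μ) atTop (𝓝 0) := by
    have h1 : ∀ n, ∫ i, ‖f n i - h‖ ∂μ
        = (blockEntropy μ n / n - h) + 2 * ∫ i, max (h - f n i) 0 ∂μ := by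
      intro n
      have h2 : ∀ i, ‖f n i - h‖ = (f n i - h) + 2 * max (h - f n i) 0 := by
        intro i
        rw [Real.norm_eq_abs]
        rcases le_total (h - f n i) 0 with h3 | h3
        · rw [max_eq_right h3, abs_of_nonneg (by linarith)]; ring
        · rw [max_eq_left h3, abs_of_nonpos (by linarith)]; ring
      simp_rw [h2]
      have hi1 : Integrable (fun i => f n i - h) μ := (hfi n).sub (integrable_const h)
      have hi2 : Integrable (fun i => 2 * max (h - f n i) 0) μ :=
        (((integrable_const h).sub (hfi n)).sup (integrable_zero _ _ _)).const_mul 2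
      rw [integral_add hi1 hi2, integral_sub (hfi n) (integrable_const h), hmean,
        integral_const_mul]
      simp
    simp_rw [h1]
    have := ((tendsto_blockEntropy_div_entropy hμ').sub_const h).add (hdef.const_mul 2)
    simpa [hh] using this
  have hM : TendstoInMeasure μ f atTop fun _ => h := by
    refine tendstoInMeasure_of_tendsto_eLpNorm one_ne_zero
      (fun n => (hfm n).aestronglyMeasurable) aestronglyMeasurable_const ?_
    have h1 : ∀ n, eLpNorm (f n - fun _ => h) 1 μ = ENNReal.ofReal (∫ i, ‖f n i - h‖ ∂μ) := by
      intro n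
      rw [eLpNorm_one_eq_lintegral_enorm,
        ← ofReal_integral_norm_eq_lintegral_enorm ((hfi n).sub (integrable_const h))]
      rfl
    simp_rw [h1]
    simpa using ENNReal.tendsto_ofReal hL1
  exact hM.exists_seq_tendsto_ae

section Growth

/-- An eventual bound holds for all indices after multiplication by a large constant. -/
theorem exists_nat_forall_le_mul {u v : ℕ → ℝ} (hv : ∀ n, 0 < v n)
    (h : ∀ᶠ n in atTop, u n ≤ v n) : ∃ K : ℕ, ∀ K' : ℕ, K ≤ K' → ∀ n, u n ≤ K' * v n := by
  obtain ⟨N, hN⟩ := eventually_atTop.1 h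
  obtain ⟨K, hK⟩ := exists_nat_ge (1 + ∑ n ∈ Finset.range N, |u n| / v n)
  refine ⟨K, fun K' hK' n => ?_⟩
  have hs : 0 ≤ ∑ n ∈ Finset.range N, |u n| / v n :=
    Finset.sum_nonneg fun n _ => div_nonneg (abs_nonneg _) (hv n).le
  have hK'' : (K : ℝ) ≤ K' := Nat.cast_le.2 hK'
  rcases lt_or_ge n N with hn | hn
  · have h1 : |u n| / v n ≤ ∑ n ∈ Finset.range N, |u n| / v n :=
      Finset.single_le_sum (f := fun n => |u n| / v n)
        (fun n _ => div_nonneg (abs_nonneg _) (hv n).le) (Finset.mem_range.2 hn)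
    rw [← div_le_iff₀ (hv n)]
    refine le_trans ?_ (show |u n| / v n ≤ K' by linarith)
    exact div_le_div_of_nonneg_right (le_abs_self _) (hv n).le
  · have h1 := hN n hn
    nlinarith [hv n]

theorem eventually_exp_le_prod_le {a : ℕ → ℝ} (ha : ∀ k, 0 < a k) {c ε : ℝ} (hε : 0 < ε)
    (h : Tendsto (fun n : ℕ => (∑ k ∈ Finset.range n, Real.log (a k)) / n) atTop (𝓝 c)) :
    ∀ᶠ n : ℕ in atTop, Real.exp (n * (c - ε)) ≤ ∏ k ∈ Finset.range n, a k ∧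
      ∏ k ∈ Finset.range n, a k ≤ Real.exp (n * (c + ε)) := by
  filter_upwards [h.eventually (lt_mem_nhds (show c - ε < c by linarith)),
    h.eventually (gt_mem_nhds (show c < c + ε by linarith)), eventually_gt_atTop 0]
    with n h1 h2 hn
  have hn0 : (0 : ℝ) < n := Nat.cast_pos.2 hn
  have hp : 0 < ∏ k ∈ Finset.range n, a k := Finset.prod_pos fun k _ => ha k
  rw [lt_div_iff₀ hn0] at h1
  rw [div_lt_iff₀ hn0] at h2
  rw [← Real.log_prod fun k _ => (ha k).ne'] at h1 h2
  rw [← Real.le_log_iff_exp_le hp, ← Real.log_le_iff_le_exp hp]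
  constructor <;> linarith

end Growth

/-- Error sequences whose partial products grow like `exp (n c)`, up to `exp (n ε)` and a uniform
multiplicative constant `K`. -/
def errorSet (c ε : ℝ) (K : ℕ) : Set (ℕ → ℝ) :=
  {y | (∀ k, 0 < y k) ∧ ∀ n : ℕ,
    Real.exp (n * (c - ε)) ≤ K * ∏ k ∈ Finset.range n, y k ∧
      ∏ k ∈ Finset.range n, y k ≤ K * Real.exp (n * (c + ε))}

/-- Sequences of letters whose partial products of contraction ratios grow like `exp (n c)` and
whose cylinders have mass at most `exp (-n h)`, up to `exp (n ε)` and a uniform multiplicative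
constant `K`. -/
def wordSet (lam : Fin m → ℝ) (μ : Measure (Seq m)) (c h ε : ℝ) (K : ℕ) : Set (Seq m) :=
  {i | ∀ n : ℕ, (Real.exp (n * (c - ε)) ≤ K * ∏ k ∈ Finset.range n, lam (i k) ∧
      ∏ k ∈ Finset.range n, lam (i k) ≤ K * Real.exp (n * (c + ε))) ∧
      μ.real (wordCylinder (pref n i)) ≤ K * Real.exp (-(n * (h - ε)))}

theorem measurableSet_errorSet (c ε : ℝ) (K : ℕ) : MeasurableSet (errorSet c ε K) := by
  have hp : ∀ n, Measurable fun y : ℕ → ℝ => ∏ k ∈ Finset.range n, y k := fun n =>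
    Finset.measurable_prod _ fun k _ => measurable_pi_apply k
  unfold errorSet
  simp only [Set.ofPred_and, Set.ofPred_forall]
  exact (MeasurableSet.iInter fun k => measurableSet_lt measurable_const (measurable_pi_apply k)).inter
    (MeasurableSet.iInter fun n => (measurableSet_le measurable_const ((hp n).const_mul _)).inter
      (measurableSet_le (hp n) measurable_const))

theorem measurable_prod_lam (lam : Fin m → ℝ) (n : ℕ) :
    Measurable fun i : Seq m => ∏ k ∈ Finset.range n, lam (i k) :=
  Finset.measurable_prod _ fun k _ => (measurable_of_finite lam).comp (measurable_pi_apply k)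

theorem measurableSet_wordSet (lam : Fin m → ℝ) (μ : Measure (Seq m)) (c h ε : ℝ) (K : ℕ) :
    MeasurableSet (wordSet lam μ c h ε K) := by
  have hp := measurable_prod_lam lam
  unfold wordSet
  simp only [Set.ofPred_and, Set.ofPred_forall]
  exact MeasurableSet.iInter fun n => ((measurableSet_le measurable_const ((hp n).const_mul _)).inter
      (measurableSet_le (hp n) measurable_const)).inter
      (measurableSet_le (measurable_comp_pref fun w : Fin n → Fin m => μ.real (wordCylinder w))
        measurable_const)

section Averages

variable {η : Measure ℝ} [IsProbabilityMeasure η]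

theorem ae_error_pos (hpos : η (Set.Iic 0) = 0) :
    ∀ᵐ y ∂(Measure.infinitePi fun _ : ℕ => η), ∀ k, 0 < y k := by
  refine ae_all_iff.2 fun k => ?_
  have h1 : ∀ᵐ t ∂η, 0 < t := by
    filter_upwards [measure_eq_zero_iff_ae_notMem.1 hpos] with t ht using not_le.1 ht
  exact (measurePreserving_eval_infinitePi (fun _ : ℕ => η) k).quasiMeasurePreserving.ae h1

theorem ae_tendsto_log_error (hlog : Integrable Real.log η) :
    ∀ᵐ y ∂(Measure.infinitePi fun _ : ℕ => η), Tendsto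
      (fun n : ℕ => (∑ k ∈ Finset.range n, Real.log (y k)) / n) atTop (𝓝 (∫ t, Real.log t ∂η)) := by
  have hev := measurePreserving_eval_infinitePi (fun _ : ℕ => η)
  have hind := ProbabilityTheory.iIndepFun_infinitePi (P := fun _ : ℕ => η)
    (X := fun _ => Real.log) fun _ => Real.measurable_log
  have h := ProbabilityTheory.strong_law_ae_real
    (μ := Measure.infinitePi fun _ : ℕ => η) (fun k y => Real.log (y k))
    ((hev 0).integrable_comp_of_integrable hlog)
    (fun i j hij => hind.indepFun hij)
    (fun k => by
      refine ⟨(Real.measurable_log.comp (measurable_pi_apply k)).aemeasurable,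
        (Real.measurable_log.comp (measurable_pi_apply 0)).aemeasurable, ?_⟩
      have h1 : ∀ k : ℕ, (Measure.infinitePi fun _ : ℕ => η).map (fun y => Real.log (y k))
          = η.map Real.log := fun k => by
        conv_rhs => rw [← (hev k).map_eq]
        rw [Measure.map_map Real.measurable_log (measurable_pi_apply k)]
        rfl
      rw [h1 k, h1 0])
  have h2 : ∫ y, Real.log (y 0) ∂(Measure.infinitePi fun _ : ℕ => η) = ∫ t, Real.log t ∂η := by
    conv_rhs => rw [← (hev 0).map_eq]
    rw [integral_map (hev 0).measurable.aemeasurable Real.measurable_log.aestronglyMeasurable]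
  rw [h2] at h
  exact h

theorem ae_exists_mem_errorSet (hpos : η (Set.Iic 0) = 0) (hlog : Integrable Real.log η)
    {ε : ℝ} (hε : 0 < ε) :
    ∀ᵐ y ∂(Measure.infinitePi fun _ : ℕ => η), ∃ K, y ∈ errorSet (∫ t, Real.log t ∂η) ε K := by
  filter_upwards [ae_error_pos hpos, ae_tendsto_log_error hlog] with y hy hy2
  have h1 := eventually_exp_le_prod_le hy hε hy2
  obtain ⟨K₁, hK₁⟩ := exists_nat_forall_le_mul
    (fun n => Finset.prod_pos fun k _ => hy k) (h1.mono fun n hn => hn.1)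
  obtain ⟨K₂, hK₂⟩ := exists_nat_forall_le_mul
    (fun n => Real.exp_pos _) (h1.mono fun n hn => hn.2)
  exact ⟨max K₁ K₂, hy, fun n => ⟨hK₁ _ (le_max_left _ _) n, hK₂ _ (le_max_right _ _) n⟩⟩

theorem ae_tendsto_log_lam {μ : Measure (Seq m)} [IsProbabilityMeasure μ]
    (hμ : Ergodic (shift (m := m)) μ) (lam : Fin m → ℝ) :
    ∀ᵐ i ∂μ, Tendsto (fun n : ℕ => (∑ k ∈ Finset.range n, Real.log (lam (i k))) / n) atTop
      (𝓝 (∫ i : Seq m, Real.log (lam (i 0)) ∂μ)) := by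
  have hm : Measurable fun i : Seq m => Real.log (lam (i 0)) :=
    (measurable_of_finite fun j => Real.log (lam j)).comp (measurable_pi_apply 0)
  have hi : Integrable (fun i : Seq m => Real.log (lam (i 0))) μ := by
    refine Integrable.of_bound (C := ∑ j, ‖Real.log (lam j)‖) hm.aestronglyMeasurable
      (ae_of_all _ fun i => ?_)
    exact Finset.single_le_sum (f := fun j => ‖Real.log (lam j)‖)
      (fun _ _ => norm_nonneg _) (Finset.mem_univ (i 0))
  filter_upwards [ae_tendsto_birkhoffSum_div hμ hm hi] with i h
  refine h.congr fun n => ?_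
  simp [birkhoffSum, shift_iterate_apply]

theorem ae_exists_mem_wordSet {μ : Measure (Seq m)} [IsProbabilityMeasure μ]
    (hμ : Ergodic (shift (m := m)) μ) {lam : Fin m → ℝ} (hlam : ∀ j, 0 < lam j)
    {ε : ℝ} (hε : 0 < ε) :
    ∀ᵐ i ∂μ, ∃ K, i ∈ wordSet lam μ (∫ i : Seq m, Real.log (lam (i 0)) ∂μ) (entropy μ) ε K := by
  filter_upwards [ae_tendsto_log_lam hμ lam, ae_eventually_measureReal_cylinder_le hμ] with i h1 h2
  have h3 := eventually_exp_le_prod_le (fun k => hlam (i k)) hε h1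
  obtain ⟨K₁, hK₁⟩ := exists_nat_forall_le_mul
    (fun n => Finset.prod_pos fun k _ => hlam (i k)) (h3.mono fun n hn => hn.1)
  obtain ⟨K₂, hK₂⟩ := exists_nat_forall_le_mul
    (fun n => Real.exp_pos _) (h3.mono fun n hn => hn.2)
  obtain ⟨K₃, hK₃⟩ := exists_nat_forall_le_mul (fun n => Real.exp_pos _) (h2 ε hε)
  refine ⟨max K₁ (max K₂ K₃), fun n => ⟨⟨hK₁ _ (le_max_left _ _) n, hK₂ _ ?_ n⟩, hK₃ _ ?_ n⟩⟩
  · exact (le_max_left _ _).trans (le_max_right _ _)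
  · exact (le_max_right _ _).trans (le_max_right _ _)

end Averages

end RandomIFS

/-! ### Transversality -/

/-- Resampling one coordinate independently preserves a product measure. -/
theorem measurePreserving_update_infinitePi {Ω : Type*} [MeasurableSpace Ω] (η : Measure Ω)
    [IsProbabilityMeasure η] (N : ℕ) :
    MeasurePreserving (fun p : (ℕ → Ω) × Ω => Function.update p.1 N p.2)
      ((Measure.infinitePi fun _ : ℕ => η).prod η) (Measure.infinitePi fun _ : ℕ => η) := by
  have hm : Measurable fun p : (ℕ → Ω) × Ω => Function.update p.1 N p.2 := measurable_update'
  refine ⟨hm, Measure.eq_infinitePi (μ := fun _ : ℕ => η) fun s T hT => ?_⟩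
  rw [Measure.map_apply hm (MeasurableSet.pi s.countable_toSet fun i _ => hT i)]
  by_cases hN : N ∈ s
  · have h1 : (fun p : (ℕ → Ω) × Ω => Function.update p.1 N p.2) ⁻¹' Set.pi s T
        = Set.pi (s.erase N) T ×ˢ T N := by
      ext ⟨y, t⟩
      simp only [Set.mem_preimage, Set.mem_pi, Set.mem_prod, Finset.coe_erase, Set.mem_sdiff,
        Set.mem_singleton_iff, Finset.mem_coe]
      constructor
      · intro h
        refine ⟨fun i hi => ?_, ?_⟩
        · simpa [Function.update_of_ne hi.2] using h i hi.1
        · simpa using h N hN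
      · rintro ⟨h1, h2⟩ i hi
        by_cases hiN : i = N
        · subst hiN; simpa using h2
        · simpa [Function.update_of_ne hiN] using h1 i ⟨hi, hiN⟩
    rw [h1, Measure.prod_prod, Measure.infinitePi_pi _ fun i _ => hT i]
    exact Finset.prod_erase_mul s (fun i => η (T i)) hN
  · have h1 : (fun p : (ℕ → Ω) × Ω => Function.update p.1 N p.2) ⁻¹' Set.pi s T
        = Set.pi s T ×ˢ Set.univ := by
      ext ⟨y, t⟩
      simp only [Set.mem_preimage, Set.mem_pi, Set.mem_prod, Set.mem_univ, and_true, Finset.mem_coe]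
      refine forall₂_congr fun i hi => ?_
      rw [Function.update_of_ne (fun h : i = N => hN (h ▸ hi))]
    rw [h1, Measure.prod_prod, Measure.infinitePi_pi _ fun i _ => hT i, measure_univ, mul_one]

namespace RandomIFS

section Transversality

variable {η : Measure ℝ} [IsProbabilityMeasure η]

/-- A random affine image `a + t b` with `|a|` bounded below is rarely close to `0`, uniformly in
the slope `b`: the slope moves the relevant window of `t` to the scale `1 / |b|`, where the bound
`C₁ / t` on the density compensates its length. -/
theorem measure_abs_add_mul_le (hac : η ≪ volume) {C₁ : ℝ} (hC₁ : 0 < C₁)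
    (hdens : ∀ᵐ x : ℝ, 0 < x → η.rnDeriv volume x ≤ ENNReal.ofReal (C₁ / x))
    {a₀ : ℝ} (ha₀ : 0 < a₀) {a : ℝ} (ha : a₀ ≤ |a|) (b : ℝ) {ρ : ℝ} (hρ : 0 ≤ ρ) :
    η {t | 0 < t ∧ |a + t * b| ≤ ρ} ≤ ENNReal.ofReal ((4 * C₁ + 2) / a₀ * ρ) := by
  rcases le_or_gt (a₀ / 2) ρ with hρ2 | hρ2
  · refine prob_le_one.trans ?_
    rw [ENNReal.one_le_ofReal, div_mul_eq_mul_div, le_div_iff₀ ha₀]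
    nlinarith
  set S := {t | 0 < t ∧ |a + t * b| ≤ ρ} with hS
  rcases eq_or_ne b 0 with rfl | hb
  · have : S = ∅ := by
      ext t
      simp only [hS, mul_zero, add_zero, Set.mem_ofPred_eq, Set.mem_empty_iff_false, iff_false,
        not_and, not_le]
      intro _
      linarith
    rw [this, measure_empty]
    exact zero_le
  have hb' : 0 < |b| := abs_pos.2 hb
  have hlow : ∀ t ∈ S, a₀ / (2 * |b|) ≤ t := by
    rintro t ⟨ht, ht2⟩
    have h1 : |a| ≤ |a + t * b| + |t * b| := by
      calc |a| = |(a + t * b) - t * b| := by ring_nf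
        _ ≤ _ := abs_sub _ _
    rw [abs_mul, abs_of_pos ht] at h1
    rw [div_le_iff₀ (by positivity)]
    linarith
  have hsub : S ⊆ Metric.closedBall (-(a / b)) (ρ / |b|) := by
    rintro t ⟨ht, ht2⟩
    rw [Metric.mem_closedBall, Real.dist_eq, le_div_iff₀ hb', ← abs_mul]
    have : (t - -(a / b)) * b = a + t * b := by field_simp; ring
    rwa [this]
  have hSm : MeasurableSet S :=
    (measurableSet_lt measurable_const measurable_id).inter
      (measurableSet_le (measurable_const.add (measurable_id.mul_const b)).abs measurable_const)
  calc η S = ∫⁻ t in S, η.rnDeriv volume t := (Measure.setLIntegral_rnDeriv hac S).symm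
    _ ≤ ∫⁻ _ in S, ENNReal.ofReal (C₁ / (a₀ / (2 * |b|))) := by
        refine lintegral_mono_ae ?_
        filter_upwards [ae_restrict_of_ae hdens, ae_restrict_mem hSm] with t ht htS
        refine (ht htS.1).trans (ENNReal.ofReal_le_ofReal ?_)
        exact div_le_div_of_nonneg_left hC₁.le (by positivity) (hlow t htS)
    _ = ENNReal.ofReal (C₁ / (a₀ / (2 * |b|))) * volume S := by simp
    _ ≤ ENNReal.ofReal (C₁ / (a₀ / (2 * |b|))) * ENNReal.ofReal (2 * (ρ / |b|)) := by
        gcongr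
        rw [← Real.volume_closedBall]
        exact measure_mono hsub
    _ = ENNReal.ofReal (4 * C₁ / a₀ * ρ) := by
        rw [← ENNReal.ofReal_mul (by positivity)]
        congr 1
        field_simp
        ring
    _ ≤ ENNReal.ofReal ((4 * C₁ + 2) / a₀ * ρ) := by
        refine ENNReal.ofReal_le_ofReal ?_
        gcongr
        linarith

/-- The same estimate for a random slope that does not depend on the `N`-th error. -/
theorem infinitePi_abs_add_mul_le (hac : η ≪ volume) {C₁ : ℝ} (hC₁ : 0 < C₁)
    (hdens : ∀ᵐ x : ℝ, 0 < x → η.rnDeriv volume x ≤ ENNReal.ofReal (C₁ / x))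
    {a₀ : ℝ} (ha₀ : 0 < a₀) {a : ℝ} (ha : a₀ ≤ |a|) {N : ℕ} {b : (ℕ → ℝ) → ℝ} (hb : Measurable b)
    (hbN : ∀ y t, b (Function.update y N t) = b y) {ρ : ℝ} (hρ : 0 ≤ ρ) :
    Measure.infinitePi (fun _ : ℕ => η) {y | 0 < y N ∧ |a + y N * b y| ≤ ρ}
      ≤ ENNReal.ofReal ((4 * C₁ + 2) / a₀ * ρ) := by
  set P := Measure.infinitePi fun _ : ℕ => η
  set E : Set (ℕ → ℝ) := {y | 0 < y N ∧ |a + y N * b y| ≤ ρ} with hE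
  have hEm : MeasurableSet E :=
    (measurableSet_lt measurable_const (measurable_pi_apply N)).inter
      (measurableSet_le (measurable_const.add ((measurable_pi_apply N).mul hb)).abs
        measurable_const)
  have hmp := measurePreserving_update_infinitePi η N
  rw [← hmp.measure_preimage hEm.nullMeasurableSet, Measure.prod_apply (hmp.measurable hEm)]
  calc ∫⁻ y, η (Prod.mk y ⁻¹' ((fun p : (ℕ → ℝ) × ℝ => Function.update p.1 N p.2) ⁻¹' E)) ∂P
      ≤ ∫⁻ _, ENNReal.ofReal ((4 * C₁ + 2) / a₀ * ρ) ∂P := by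
        refine lintegral_mono fun y => ?_
        refine le_trans (measure_mono ?_) (measure_abs_add_mul_le hac hC₁ hdens ha₀ ha (b y) hρ)
        intro t ht
        simpa [hE, hbN] using ht
    _ = ENNReal.ofReal ((4 * C₁ + 2) / a₀ * ρ) := by simp

end Transversality

section Projection

variable {m : ℕ} (d lam : Fin m → ℝ)

/-- The sequence with its first `n` terms removed. -/
def tail {α : Type*} (n : ℕ) (x : ℕ → α) : ℕ → α := fun k => x (n + k)

theorem measurable_tail {α : Type*} [MeasurableSpace α] (n : ℕ) :
    Measurable (tail (α := α) n) :=
  measurable_pi_lambda _ fun k => measurable_pi_apply (n + k)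

theorem term_tail (y : ℕ → ℝ) (i : Seq m) (n k : ℕ) :
    term d lam y i (k + n) = (∏ l ∈ Finset.range n, lam (i l)) * (∏ l ∈ Finset.range n, y l)
      * term d lam (tail n y) (tail n i) k := by
  rw [add_comm k n, term, term, Finset.prod_range_add, Finset.prod_range_add]
  simp only [tail]
  ring

theorem proj_eq_sum_add_proj_tail {y : ℕ → ℝ} {i : Seq m} (h : Summable (term d lam y i)) (n : ℕ) :
    proj d lam y i = ∑ k ∈ Finset.range n, term d lam y i k
      + (∏ l ∈ Finset.range n, lam (i l)) * (∏ l ∈ Finset.range n, y l)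
      * proj d lam (tail n y) (tail n i) := by
  rw [proj, ← h.sum_add_tsum_nat_add n, proj, ← tsum_mul_left]
  simp_rw [term_tail]

theorem measurable_proj_uncurry :
    Measurable fun p : (ℕ → ℝ) × Seq m => proj d lam p.1 p.2 := by
  refine Measurable.tsum fun n => ?_
  have h1 : ∀ (f : Fin m → ℝ) (k : ℕ), Measurable fun p : (ℕ → ℝ) × Seq m => f (p.2 k) :=
    fun f k => (measurable_of_finite f).comp ((measurable_pi_apply k).comp measurable_snd)
  exact ((h1 d n).mul (Finset.measurable_prod _ fun k _ => h1 lam k)).mul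
    (Finset.measurable_prod _ fun k _ => (measurable_pi_apply k).comp measurable_fst)

theorem measurable_proj_left (i : Seq m) : Measurable fun y : ℕ → ℝ => proj d lam y i :=
  (measurable_proj_uncurry d lam).comp (measurable_id.prodMk measurable_const)

theorem tail_update_of_lt {α : Type*} {N n : ℕ} (h : N < n) (y : ℕ → α) (t : α) :
    tail n (Function.update y N t) = tail n y := by
  funext k
  exact Function.update_of_ne (by omega) _ _

theorem exists_pos_forall_le_abs_sub {v : Fin m → ℝ} (hv : ∀ i j, i ≠ j → v i ≠ v j) :
    ∃ a₀ : ℝ, 0 < a₀ ∧ ∀ i j, i ≠ j → a₀ ≤ |v i - v j| := by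
  have h : ∀ᶠ a in 𝓝[>] (0 : ℝ), ∀ i j, i ≠ j → a ≤ |v i - v j| := by
    refine eventually_all.2 fun i => eventually_all.2 fun j => ?_
    by_cases hij : i = j
    · simp [hij]
    · filter_upwards [Ioc_mem_nhdsGT (abs_pos.2 (sub_ne_zero.2 (hv i j hij)))] with a ha _
      exact ha.2
  obtain ⟨a, ha, hpos⟩ := (h.and self_mem_nhdsWithin).exists
  exact ⟨a, hpos, ha⟩

/-- The difference of the projections of two sequences that first differ at the letter `n` is,
up to the common factor, affine in one error variable (the first one that is not common, or
the next one when all digits coincide) with a constant term bounded away from `0` and a slope that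
depends on the later errors only. -/
theorem exists_proj_sub_proj_eq
    (hcond : (∀ i j, i ≠ j → d i ≠ d j) ∨ ((∀ i, d i = 1) ∧ ∀ i j, i ≠ j → lam i ≠ lam j)) :
    ∃ (e : ℕ) (a₀ : ℝ), 0 < a₀ ∧ ∀ (n : ℕ) (i j : Seq m), (∀ k < n, i k = j k) → i n ≠ j n →
      ∃ (a : ℝ) (b : (ℕ → ℝ) → ℝ), a₀ ≤ |a| ∧ Measurable b ∧
        (∀ y t, b (Function.update y (n + e) t) = b y) ∧
        ∀ y, Summable (term d lam y i) → Summable (term d lam y j) →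
          proj d lam y i - proj d lam y j = (∏ k ∈ Finset.range n, lam (i k))
            * (∏ k ∈ Finset.range (n + e), y k) * (a + y (n + e) * b y) := by
  have hprod : ∀ {n : ℕ} {i j : Seq m}, (∀ k < n, i k = j k) →
      ∏ k ∈ Finset.range n, lam (j k) = ∏ k ∈ Finset.range n, lam (i k) := fun h =>
    Finset.prod_congr rfl fun k hk => by rw [h k (Finset.mem_range.1 hk)]
  have hsum : ∀ {n : ℕ} {i j : Seq m} (y : ℕ → ℝ), (∀ k < n, i k = j k) →
      ∑ k ∈ Finset.range n, term d lam y j k = ∑ k ∈ Finset.range n, term d lam y i k := by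
    intro n i j y h
    refine Finset.sum_congr rfl fun k hk => ?_
    have hk' := Finset.mem_range.1 hk
    rw [term, term, hprod fun l hl => h l (hl.trans hk'), h k hk']
  have hmeas : ∀ (c : ℝ) (n : ℕ) (i : Seq m),
      Measurable fun y : ℕ → ℝ => c * proj d lam (tail n y) (tail n i) := fun c n i =>
    ((measurable_proj_left d lam _).comp (measurable_tail n)).const_mul c
  rcases hcond with hd | ⟨hd, hl⟩
  · obtain ⟨a₀, ha₀, h⟩ := exists_pos_forall_le_abs_sub hd
    refine ⟨0, a₀, ha₀, fun n i j hij hn => ⟨d (i n) - d (j n), fun y =>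
      lam (i n) * proj d lam (tail (n + 1) y) (tail (n + 1) i)
        - lam (j n) * proj d lam (tail (n + 1) y) (tail (n + 1) j), h _ _ hn,
      (hmeas _ _ _).sub (hmeas _ _ _), fun y t => ?_, fun y hi hj => ?_⟩⟩
    · simp only [tail_update_of_lt (show n + 0 < n + 1 by omega)]
    · rw [proj_eq_sum_add_proj_tail d lam hi (n + 1), proj_eq_sum_add_proj_tail d lam hj (n + 1)]
      simp only [Finset.sum_range_succ, Finset.prod_range_succ, term, add_zero]
      have h1 := hsum y hij
      simp only [term] at h1
      rw [h1, hprod hij]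
      ring
  · obtain ⟨a₀, ha₀, h⟩ := exists_pos_forall_le_abs_sub hl
    refine ⟨1, a₀, ha₀, fun n i j hij hn => ⟨lam (i n) - lam (j n), fun y =>
      lam (i n) * lam (i (n + 1)) * proj d lam (tail (n + 2) y) (tail (n + 2) i)
        - lam (j n) * lam (j (n + 1)) * proj d lam (tail (n + 2) y) (tail (n + 2) j), h _ _ hn,
      (hmeas _ _ _).sub (hmeas _ _ _), fun y t => ?_, fun y hi hj => ?_⟩⟩
    · simp only [tail_update_of_lt (show n + 1 < n + 2 by omega)]
    · rw [proj_eq_sum_add_proj_tail d lam hi (n + 2), proj_eq_sum_add_proj_tail d lam hj (n + 2)]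
      simp only [Finset.sum_range_succ, Finset.prod_range_succ, term, hd]
      have h1 := hsum y hij
      simp only [term, hd] at h1
      rw [h1, hprod hij]
      ring

end Projection

section Series

variable {m : ℕ} (d : Fin m → ℝ) {lam : Fin m → ℝ}

theorem abs_term_le (hlam : ∀ j, 0 < lam j) {c L h ε : ℝ} {K J : ℕ} {μ : Measure (Seq m)}
    {y : ℕ → ℝ} {i : Seq m} (hy : y ∈ errorSet c ε K) (hi : i ∈ wordSet lam μ L h ε J) (n : ℕ) :
    |term d lam y i n| ≤ (∑ j, |d j|) * K * J * Real.exp (c + L + 2 * ε) ^ n := by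
  have h1 : |d (i n)| ≤ ∑ j, |d j| :=
    Finset.single_le_sum (f := fun j => |d j|) (fun _ _ => abs_nonneg _) (Finset.mem_univ _)
  have h2 := ((hi n).1).2
  have h3 := (hy.2 n).2
  have h4 : 0 ≤ ∏ k ∈ Finset.range n, lam (i k) := Finset.prod_nonneg fun k _ => (hlam _).le
  have h5 : 0 ≤ ∏ k ∈ Finset.range n, y k := Finset.prod_nonneg fun k _ => (hy.1 _).le
  rw [term, abs_mul, abs_mul, abs_of_nonneg h4, abs_of_nonneg h5]
  calc |d (i n)| * (∏ k ∈ Finset.range n, lam (i k)) * ∏ k ∈ Finset.range n, y k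
      ≤ (∑ j, |d j|) * (J * Real.exp (n * (L + ε))) * (K * Real.exp (n * (c + ε))) := by gcongr
    _ = (∑ j, |d j|) * K * J * Real.exp (c + L + 2 * ε) ^ n := by
        rw [← Real.exp_nat_mul,
          show (n : ℝ) * (c + L + 2 * ε) = n * (L + ε) + n * (c + ε) by ring, Real.exp_add]
        ring

theorem summable_term (hlam : ∀ j, 0 < lam j) {c L h ε : ℝ} (hχ : c + L + 2 * ε < 0) {K J : ℕ}
    {μ : Measure (Seq m)} {y : ℕ → ℝ} {i : Seq m} (hy : y ∈ errorSet c ε K)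
    (hi : i ∈ wordSet lam μ L h ε J) : Summable (term d lam y i) := by
  refine Summable.of_norm_bounded (g := fun n =>
    (∑ j, |d j|) * K * J * Real.exp (c + L + 2 * ε) ^ n) ?_ fun n => abs_term_le d hlam hy hi n
  exact (summable_geometric_of_lt_one (Real.exp_pos _).le (Real.exp_lt_one_iff.2 hχ)).mul_left _

end Series

end RandomIFS

/-! ### The energy estimate -/

/-- The mass that `ρ ⊗ ρ` gives to the pairs at distance at most `r`: the average over `x` of the
mass of the ball of radius `r` about `x`. -/
def ballEnergy (ρ : Measure ℝ) (r : ℝ) : ℝ≥0∞ :=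
  ∫⁻ x, ρ (Metric.closedBall x r) ∂ρ

namespace RandomIFS

theorem measurableSet_abs_sub_le (r : ℝ) : MeasurableSet {p : ℝ × ℝ | |p.1 - p.2| ≤ r} :=
  measurableSet_le (measurable_fst.sub measurable_snd).abs measurable_const

theorem measurable_measure_closedBall (ρ : Measure ℝ) [SFinite ρ] (r : ℝ) :
    Measurable fun x => ρ (Metric.closedBall x r) := by
  have h := measurable_measure_prodMk_left (ν := ρ) (measurableSet_abs_sub_le r)
  refine (congrArg Measurable (funext fun x => ?_)).mp h
  congr 1
  ext z
  simp [Real.dist_eq, abs_sub_comm]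

theorem ballEnergy_eq_prod (ρ : Measure ℝ) [SFinite ρ] (r : ℝ) :
    ballEnergy ρ r = (ρ.prod ρ) {p | |p.1 - p.2| ≤ r} := by
  rw [Measure.prod_apply (measurableSet_abs_sub_le r), ballEnergy]
  refine lintegral_congr fun x => ?_
  congr 1
  ext z
  simp [Real.dist_eq, abs_sub_comm]

theorem min_one_le_rpow {x s : ℝ} (hx : 0 ≤ x) (hs0 : 0 ≤ s) (hs1 : s ≤ 1) :
    min 1 x ≤ x ^ s := by
  rcases le_total 1 x with h | h
  · exact (min_le_left _ _).trans (Real.one_le_rpow h hs0)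
  · refine (min_le_right _ _).trans ?_
    rcases hx.eq_or_lt with rfl | hx
    · exact Real.rpow_nonneg le_rfl s
    · simpa using Real.rpow_le_rpow_of_exponent_ge hx h hs1

variable {m : ℕ} (d lam : Fin m → ℝ)

section

variable (ν : Measure (Seq m)) [SFinite ν]

theorem ballEnergy_map_proj (y : ℕ → ℝ) (r : ℝ) :
    ballEnergy (ν.map (proj d lam y)) r
      = (ν.prod ν) {p | |proj d lam y p.1 - proj d lam y p.2| ≤ r} := by
  have hm := measurable_proj d lam y
  rw [ballEnergy_eq_prod, Measure.map_prod_map _ _ hm hm,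
    Measure.map_apply (hm.prodMap hm) (measurableSet_abs_sub_le r)]
  rfl

theorem measurableSet_proj_dist_le (r : ℝ) : MeasurableSet {q : (ℕ → ℝ) × Seq m × Seq m |
    |proj d lam q.1 q.2.1 - proj d lam q.1 q.2.2| ≤ r} := by
  have h := measurable_proj_uncurry d lam
  exact measurableSet_le ((h.comp (measurable_fst.prodMk (measurable_fst.comp measurable_snd))).sub
    (h.comp (measurable_fst.prodMk (measurable_snd.comp measurable_snd)))).abs measurable_const

theorem measurable_ballEnergy_map_proj (r : ℝ) :
    Measurable fun y => ballEnergy (ν.map (proj d lam y)) r := by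
  simp_rw [ballEnergy_map_proj]
  exact measurable_measure_prodMk_left (measurableSet_proj_dist_le d lam r)

theorem lintegral_ballEnergy_map_proj (Q : Measure (ℕ → ℝ)) [SFinite Q] (r : ℝ) :
    ∫⁻ y, ballEnergy (ν.map (proj d lam y)) r ∂Q
      = ∫⁻ i, ∫⁻ j, Q {y | |proj d lam y i - proj d lam y j| ≤ r} ∂ν ∂ν := by
  have hG := measurableSet_proj_dist_le d lam r
  simp_rw [ballEnergy_map_proj]
  have h1 := Measure.prod_apply (μ := Q) (ν := ν.prod ν) hG
  rw [Measure.prod_apply_symm hG, lintegral_prod _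
    (measurable_measure_prodMk_right hG).aemeasurable] at h1
  exact h1.symm

end

variable {d lam}

/-- The probability that two codes with a common prefix of length exactly `n` project within
distance `r` of each other. -/
theorem exists_measure_proj_dist_le (hlam : ∀ j, 0 < lam j)
    {η : Measure ℝ} [IsProbabilityMeasure η] (hac : η ≪ volume) {C₁ : ℝ} (hC₁ : 0 < C₁)
    (hdens : ∀ᵐ x : ℝ, 0 < x → η.rnDeriv volume x ≤ ENNReal.ofReal (C₁ / x))
    (hcond : (∀ i j, i ≠ j → d i ≠ d j) ∨ ((∀ i, d i = 1) ∧ ∀ i j, i ≠ j → lam i ≠ lam j))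
    {μ : Measure (Seq m)} {c L h ε s : ℝ} (hs0 : 0 ≤ s) (hs1 : s ≤ 1)
    (hχ : c + L + 2 * ε < 0) (K J : ℕ) :
    ∃ B : ℝ, 0 ≤ B ∧ ∀ r : ℝ, 0 < r → ∀ (n : ℕ), ∀ i ∈ wordSet lam μ L h ε J,
      ∀ j ∈ wordSet lam μ L h ε J, (∀ k < n, i k = j k) → i n ≠ j n →
      (Measure.infinitePi fun _ : ℕ => η).restrict (errorSet c ε K)
        {y | |proj d lam y i - proj d lam y j| ≤ r}
        ≤ ENNReal.ofReal (B * r ^ s * Real.exp (s * (2 * ε - (c + L))) ^ n) := by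
  obtain ⟨e, a₀, ha₀, H⟩ := exists_proj_sub_proj_eq d lam hcond
  set A : ℝ := (4 * C₁ + 2) / a₀ with hA
  have hA0 : 0 < A := by positivity
  set B₀ : ℝ := A * (J * K * Real.exp (-(e * (c - ε)))) with hB₀
  have hB₀0 : 0 ≤ B₀ := by positivity
  refine ⟨B₀ ^ s, Real.rpow_nonneg hB₀0 s, fun r hr n i hi j hj hij hn => ?_⟩
  obtain ⟨a, b, ha, hb, hbN, hab⟩ := H n i j hij hn
  set P := Measure.infinitePi fun _ : ℕ => η
  set q : ℝ := Real.exp (2 * ε - (c + L)) with hq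
  set ρ : ℝ := J * K * Real.exp (-(e * (c - ε))) * r * q ^ n with hρ
  have hρ0 : 0 ≤ ρ := by positivity
  have hexp : Real.exp (n * (L - ε)) * Real.exp ((n + e : ℕ) * (c - ε)) * ρ = J * K * r := by
    have h1 : Real.exp (n * (L - ε)) * Real.exp ((n + e : ℕ) * (c - ε))
        * (Real.exp (-(e * (c - ε))) * q ^ n) = 1 := by
      rw [hq, ← Real.exp_nat_mul, ← Real.exp_add, ← Real.exp_add, ← Real.exp_add, ← Real.exp_zero]
      congr 1
      push_cast
      ring
    calc _ = J * K * r * (Real.exp (n * (L - ε)) * Real.exp ((n + e : ℕ) * (c - ε))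
        * (Real.exp (-(e * (c - ε))) * q ^ n)) := by rw [hρ]; ring
      _ = _ := by rw [h1, mul_one]
  have hsub : {y | |proj d lam y i - proj d lam y j| ≤ r} ∩ errorSet c ε K
      ⊆ {y | 0 < y (n + e) ∧ |a + y (n + e) * b y| ≤ ρ} := by
    rintro y ⟨hy, hyE⟩
    refine ⟨hyE.1 _, ?_⟩
    have hy' : |proj d lam y i - proj d lam y j| ≤ r := hy
    have h1 := ((hi n).1).1
    have h2 := (hyE.2 (n + e)).1
    have h4 : 0 ≤ ∏ k ∈ Finset.range n, lam (i k) := Finset.prod_nonneg fun k _ => (hlam _).le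
    have h5 : 0 ≤ ∏ k ∈ Finset.range (n + e), y k := Finset.prod_nonneg fun k _ => (hyE.1 _).le
    rw [hab y (summable_term d hlam hχ hyE hi) (summable_term d hlam hχ hyE hj), abs_mul, abs_mul,
      abs_of_nonneg h4, abs_of_nonneg h5] at hy'
    have h6 : 0 < Real.exp (n * (L - ε)) * Real.exp ((n + e : ℕ) * (c - ε)) := by positivity
    refine le_of_mul_le_mul_left ?_ h6
    rw [hexp]
    calc Real.exp (n * (L - ε)) * Real.exp ((n + e : ℕ) * (c - ε)) * |a + y (n + e) * b y|
        ≤ (J * ∏ k ∈ Finset.range n, lam (i k)) * (K * ∏ k ∈ Finset.range (n + e), y k)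
          * |a + y (n + e) * b y| := by gcongr
      _ = J * K * ((∏ k ∈ Finset.range n, lam (i k)) * (∏ k ∈ Finset.range (n + e), y k)
          * |a + y (n + e) * b y|) := by ring
      _ ≤ J * K * r := by gcongr
  rw [Measure.restrict_apply' (measurableSet_errorSet c ε K)]
  have h1 : P ({y | |proj d lam y i - proj d lam y j| ≤ r} ∩ errorSet c ε K)
      ≤ ENNReal.ofReal (min 1 (A * ρ)) := by
    rw [ENNReal.ofReal_min, ENNReal.ofReal_one]
    exact le_min prob_le_one
      ((measure_mono hsub).trans (infinitePi_abs_add_mul_le hac hC₁ hdens ha₀ ha hb hbN hρ0))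
  refine h1.trans (ENNReal.ofReal_le_ofReal ?_)
  refine (min_one_le_rpow (mul_nonneg hA0.le hρ0) hs0 hs1).trans_eq ?_
  have h2 : A * ρ = B₀ * r * q ^ n := by rw [hρ, hB₀]; ring
  rw [h2, Real.mul_rpow (by positivity) (by positivity), Real.mul_rpow hB₀0 hr.le, hq,
    ← Real.exp_nat_mul, ← Real.exp_mul, ← Real.exp_nat_mul]
  congr 2
  ring

/-- The transversality estimate summed over the length of the common prefix. -/
theorem exists_lintegral_ballEnergy_le (hlam : ∀ j, 0 < lam j)
    {η : Measure ℝ} [IsProbabilityMeasure η] (hac : η ≪ volume) {C₁ : ℝ} (hC₁ : 0 < C₁)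
    (hdens : ∀ᵐ x : ℝ, 0 < x → η.rnDeriv volume x ≤ ENNReal.ofReal (C₁ / x))
    (hcond : (∀ i j, i ≠ j → d i ≠ d j) ∨ ((∀ i, d i = 1) ∧ ∀ i j, i ≠ j → lam i ≠ lam j))
    {μ : Measure (Seq m)} [IsProbabilityMeasure μ] {c L h ε s : ℝ} (hs0 : 0 ≤ s) (hs1 : s ≤ 1)
    (hε : 0 < ε) (hχ : c + L + 2 * ε < 0) (hs : s * (2 * ε - (c + L)) + ε < h) (K J : ℕ) :
    ∃ C : ℝ, 0 ≤ C ∧ ∀ r : ℝ, 0 < r →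
      ∫⁻ y in errorSet c ε K, ballEnergy ((μ.restrict (wordSet lam μ L h ε J)).map (proj d lam y)) r
        ∂(Measure.infinitePi fun _ : ℕ => η) ≤ ENNReal.ofReal (C * r ^ s) := by
  obtain ⟨B, hB0, hB⟩ := exists_measure_proj_dist_le (d := d) hlam hac hC₁ hdens hcond
    (μ := μ) (h := h) hs0 hs1 hχ K J
  set W := wordSet lam μ L h ε J with hW
  have hWm : MeasurableSet W := measurableSet_wordSet lam μ L h ε J
  set q : ℝ := Real.exp (s * (2 * ε - (c + L))) with hq
  set θ : ℝ := q * Real.exp (-(h - ε)) with hθ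
  have hθ0 : 0 ≤ θ := by positivity
  have hθ1 : θ < 1 := by
    rw [hθ, hq, ← Real.exp_add]
    exact Real.exp_lt_one_iff.2 (by linarith)
  have hεh : 0 < h - ε := by nlinarith [mul_nonneg hs0 (show 0 ≤ 2 * ε - (c + L) by linarith)]
  have hθ2 : 0 ≤ (1 - θ)⁻¹ := inv_nonneg.2 (by linarith)
  refine ⟨B * J * (1 - θ)⁻¹, by positivity, fun r hr => ?_⟩
  rw [lintegral_ballEnergy_map_proj]
  set Q := (Measure.infinitePi fun _ : ℕ => η).restrict (errorSet c ε K)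
  have hcyl : ∀ i ∈ W, ∀ n : ℕ, μ (wordCylinder (pref n i))
      ≤ ENNReal.ofReal (J * Real.exp (-(h - ε)) ^ n) := by
    intro i hi n
    have := (hi n).2
    rw [← ENNReal.ofReal_toReal (measure_ne_top μ (wordCylinder (pref n i)))]
    refine ENNReal.ofReal_le_ofReal ?_
    rw [← Real.exp_nat_mul, mul_neg]
    exact this
  have hinner : ∀ i ∈ W, ∫⁻ j in W, Q {y | |proj d lam y i - proj d lam y j| ≤ r} ∂μ
      ≤ ENNReal.ofReal (B * J * (1 - θ)⁻¹ * r ^ s) := by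
    intro i hi
    -- the diagonal is negligible: points of `W` are not atoms, since `ε < h`
    have hpoint : μ {i} = 0 := by
      have h1 : ∀ n, μ {i} ≤ ENNReal.ofReal (J * Real.exp (-(h - ε)) ^ n) := fun n =>
        (measure_mono (Set.singleton_subset_iff.2 (mem_wordCylinder.2 rfl))).trans (hcyl i hi n)
      have h2 : Tendsto (fun n : ℕ => ENNReal.ofReal (J * Real.exp (-(h - ε)) ^ n)) atTop (𝓝 0) := by
        have := ((tendsto_pow_atTop_nhds_zero_of_lt_one (Real.exp_pos _).le
          (Real.exp_lt_one_iff.2 (show -(h - ε) < 0 by linarith))).const_mul (J : ℝ))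
        simpa using ENNReal.tendsto_ofReal this
      exact le_antisymm (ge_of_tendsto' h2 h1) zero_le
    -- every other `j` is counted at the first position where it differs from `i`
    calc ∫⁻ j in W, Q {y | |proj d lam y i - proj d lam y j| ≤ r} ∂μ
        ≤ ∫⁻ j in W, ∑' n, (wordCylinder (pref n i)).indicator
            (fun _ => ENNReal.ofReal (B * r ^ s * q ^ n)) j ∂μ := by
          refine lintegral_mono_ae ?_
          filter_upwards [ae_restrict_mem hWm,
            ae_restrict_of_ae (measure_eq_zero_iff_ae_notMem.1 hpoint)] with j hj hji
          have hex : ∃ n, i n ≠ j n := by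
            by_contra hcon
            push Not at hcon
            exact hji (funext fun n => (hcon n).symm)
          classical
          have hlt : ∀ k < Nat.find hex, i k = j k := fun k hk =>
            not_not.1 (Nat.find_min hex hk)
          refine (hB r hr (Nat.find hex) i hi j hj hlt (Nat.find_spec hex)).trans ?_
          refine le_trans (le_of_eq ?_) (ENNReal.le_tsum (Nat.find hex))
          rw [Set.indicator_of_mem]
          exact fun k => (hlt k k.2).symm
      _ = ∑' n, ENNReal.ofReal (B * r ^ s * q ^ n) * (μ.restrict W) (wordCylinder (pref n i)) := by
          rw [lintegral_tsum fun n => (measurable_const.indicator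
            (measurableSet_wordCylinder _)).aemeasurable]
          exact tsum_congr fun n => lintegral_indicator_const (measurableSet_wordCylinder _) _
      _ ≤ ∑' n, ENNReal.ofReal (B * J * r ^ s * θ ^ n) := by
          refine ENNReal.tsum_le_tsum fun n => ?_
          refine (mul_le_mul_right ((Measure.restrict_apply_le _ _).trans (hcyl i hi n)) _).trans_eq ?_
          rw [← ENNReal.ofReal_mul (by positivity), hθ, mul_pow]
          congr 1
          ring
      _ = ENNReal.ofReal (B * J * (1 - θ)⁻¹ * r ^ s) := by
          rw [← ENNReal.ofReal_tsum_of_nonneg (fun n => by positivity)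
            ((summable_geometric_of_lt_one hθ0 hθ1).mul_left _), tsum_mul_left,
            tsum_geometric_of_lt_one hθ0 hθ1]
          congr 1
          ring
  calc ∫⁻ i in W, ∫⁻ j in W, Q {y | |proj d lam y i - proj d lam y j| ≤ r} ∂μ ∂μ
      ≤ ∫⁻ _ in W, ENNReal.ofReal (B * J * (1 - θ)⁻¹ * r ^ s) ∂μ :=
        setLIntegral_mono measurable_const hinner
    _ = ENNReal.ofReal (B * J * (1 - θ)⁻¹ * r ^ s) * μ W := by simp
    _ ≤ ENNReal.ofReal (B * J * (1 - θ)⁻¹ * r ^ s) := mul_le_of_le_one_right' prob_le_one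

end RandomIFS

/-! ### Absolute continuity and dimension from ball energies -/

section LocalDimension

open Metric

/-- A finite measure whose mean density at scale `rₙ` stays bounded along some sequence `rₙ → 0` is
absolutely continuous: by Fatou's lemma its lower density is finite almost everywhere, and the
Besicovitch covering theorem applies. -/
theorem absolutelyContinuous_of_liminf_ballEnergy (ρ : Measure ℝ) [IsFiniteMeasure ρ] {r : ℕ → ℝ}
    (hr0 : ∀ n, 0 < r n) (hr : Tendsto r atTop (𝓝 0))
    (h : liminf (fun n => (ENNReal.ofReal (r n))⁻¹ * ballEnergy ρ (r n)) atTop ≠ ∞) :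
    ρ ≪ volume := by
  have hm : ∀ n, Measurable fun x => (ENNReal.ofReal (r n))⁻¹ * ρ (closedBall x (r n)) := fun n =>
    (RandomIFS.measurable_measure_closedBall ρ (r n)).const_mul _
  have hfatou : ∫⁻ x, liminf (fun n => (ENNReal.ofReal (r n))⁻¹ * ρ (closedBall x (r n))) atTop ∂ρ
      ≠ ∞ := by
    refine ne_top_of_le_ne_top h ((lintegral_liminf_le hm).trans_eq ?_)
    congr 1
    funext n
    rw [lintegral_const_mul _ (RandomIFS.measurable_measure_closedBall ρ (r n)), ballEnergy]
  have hae := ae_lt_top (Measurable.liminf hm) hfatou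
  set S : ℕ → Set ℝ := fun M =>
    {x | ∃ᶠ n in atTop, ρ (closedBall x (r n)) ≤ M * volume (closedBall x (r n))} with hS
  have hcover : ∀ᵐ x ∂ρ, ∃ M, x ∈ S M := by
    filter_upwards [hae] with x hx
    obtain ⟨M, hM⟩ := ENNReal.exists_nat_gt hx.ne
    refine ⟨M, (frequently_lt_of_liminf_lt (by isBoundedDefault) hM).mono fun n hn => ?_⟩
    have h1 := (ENNReal.inv_mul_le_iff (by simpa using hr0 n) ENNReal.ofReal_ne_top).1 hn.le
    refine h1.trans ?_
    rw [Real.volume_closedBall, mul_comm]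
    gcongr
    linarith [hr0 n]
  have hle : ∀ (M : ℕ) (A : Set ℝ), volume A = 0 → ρ (A ∩ S M) = 0 := by
    intro M A hA
    have hten : Tendsto r atTop (𝓝[>] 0) :=
      tendsto_nhdsWithin_iff.2 ⟨hr, Eventually.of_forall hr0⟩
    have h1 : ρ (A ∩ S M) ≤ ((M : NNReal) • (volume : Measure ℝ)) (A ∩ S M) := by
      refine (Besicovitch.vitaliFamily ρ).measure_le_of_frequently_le _
        Measure.AbsolutelyContinuous.rfl _ fun x hx => ?_
      refine ((Besicovitch.tendsto_filterAt ρ x).comp hten).frequently (hx.2.mono fun n hn => ?_)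
      rw [Measure.smul_apply, ENNReal.smul_def, smul_eq_mul]
      exact hn
    refine le_antisymm (h1.trans ?_) zero_le
    rw [Measure.smul_apply, measure_mono_null Set.inter_subset_left hA, smul_zero]
  refine Measure.AbsolutelyContinuous.mk fun A _ hA => ?_
  have h1 : ρ (⋃ M, A ∩ S M) = 0 := measure_iUnion_null fun M => hle M A hA
  rw [measure_eq_zero_iff_ae_notMem] at h1 ⊢
  filter_upwards [h1, hcover] with x hx ⟨M, hM⟩ hxA
  exact hx (Set.mem_iUnion.2 ⟨M, hxA, hM⟩)

/-- The mass distribution principle, for a bound on balls of dyadic radii centred in the set. -/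
theorem hausdorffMeasure_ne_zero_of_closedBall_le (ρ : Measure ℝ) {s : ℝ} (hs : 0 < s)
    {S : Set ℝ} (hS : ρ S ≠ 0) (M : ℕ)
    (h : ∀ x ∈ S, ∀ n : ℕ, ρ (closedBall x ((1 / 2) ^ n))
      ≤ M * ENNReal.ofReal (((1 / 2 : ℝ) ^ n) ^ s)) :
    Measure.hausdorffMeasure s S ≠ 0 := by
  set κ : ℝ≥0∞ := ((M : ℝ≥0∞) + 1) * 2 ^ s with hκ
  have hκ0 : κ ≠ 0 := by
    rw [hκ]
    exact mul_ne_zero (by simp) (ENNReal.rpow_pos two_pos (by finiteness)).ne'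
  have hκt : κ ≠ ∞ := by
    rw [hκ]
    exact ENNReal.mul_ne_top (by finiteness) (ENNReal.rpow_ne_top_of_nonneg hs.le (by finiteness))
  have hκM : (M : ℝ≥0∞) * 2 ^ s ≤ κ := by rw [hκ]; gcongr; exact le_self_add
  have hmain : ∀ U : Set ℝ, ediam U ≤ 1 → ρ (closure U ∩ S) ≤ κ * ediam U ^ s := by
    intro U hU
    rcases (closure U ∩ S).eq_empty_or_nonempty with he | ⟨x, hxU, hxS⟩
    · rw [he, measure_empty]; exact zero_le
    have hUt : ediam U ≠ ∞ := ne_top_of_le_ne_top ENNReal.one_ne_top hU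
    have hsub : closure U ⊆ closedBall x (ediam U).toReal := by
      intro z hz
      rw [mem_closedBall, dist_edist]
      refine ENNReal.toReal_mono hUt ?_
      rw [← ediam_closure]
      exact edist_le_ediam_of_mem hz hxU
    set D := (ediam U).toReal with hD
    have hball : ∀ n : ℕ, D ≤ (1 / 2) ^ n →
        ρ (closure U ∩ S) ≤ M * ENNReal.ofReal (((1 / 2 : ℝ) ^ n) ^ s) := fun n hn =>
      (measure_mono (Set.inter_subset_left.trans (hsub.trans (closedBall_subset_closedBall hn)))).trans
        (h x hxS n)
    rcases (show 0 ≤ D from ENNReal.toReal_nonneg).eq_or_lt with h0 | h0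
    · have hlim : Tendsto (fun n : ℕ => (M : ℝ≥0∞) * ENNReal.ofReal (((1 / 2 : ℝ) ^ n) ^ s)) atTop
          (𝓝 0) := by
        have h1 : Tendsto (fun n : ℕ => ((1 / 2 : ℝ) ^ n) ^ s) atTop (𝓝 0) := by
          have := (tendsto_pow_atTop_nhds_zero_of_lt_one (r := (1 / 2 : ℝ)) (by norm_num)
            (by norm_num)).rpow_const (p := s) (Or.inr hs.le)
          rwa [Real.zero_rpow hs.ne'] at this
        have h2 := ENNReal.Tendsto.const_mul (a := (M : ℝ≥0∞)) (ENNReal.tendsto_ofReal h1)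
          (Or.inr (by finiteness))
        simpa using h2
      exact (ge_of_tendsto' hlim fun n => hball n (by rw [← h0]; positivity)).trans zero_le
    · have hD1 : D ≤ 1 := by simpa using ENNReal.toReal_mono ENNReal.one_ne_top hU
      obtain ⟨n, hn1, hn2⟩ := exists_nat_pow_near_of_lt_one h0 hD1
        (show (0 : ℝ) < 1 / 2 by norm_num) (by norm_num)
      have h3 : ((1 / 2 : ℝ) ^ n) ≤ 2 * D := by
        rw [pow_succ] at hn1
        linarith
      calc ρ (closure U ∩ S) ≤ M * ENNReal.ofReal (((1 / 2 : ℝ) ^ n) ^ s) := hball n hn2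
        _ ≤ M * ENNReal.ofReal ((2 * D) ^ s) := by gcongr
        _ = M * 2 ^ s * ediam U ^ s := by
            rw [← ENNReal.ofReal_rpow_of_pos (by positivity), ENNReal.ofReal_mul (by norm_num),
              ENNReal.mul_rpow_of_nonneg _ _ hs.le, hD, ENNReal.ofReal_toReal hUt, mul_assoc]
            simp
        _ ≤ κ * ediam U ^ s := by gcongr
  have hle : κ⁻¹ • ρ.restrict S ≤ Measure.hausdorffMeasure s := by
    refine Measure.le_hausdorffMeasure s _ 1 one_pos fun U hU => ?_
    rw [Measure.smul_apply, smul_eq_mul, ENNReal.inv_mul_le_iff hκ0 hκt]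
    calc ρ.restrict S U ≤ ρ.restrict S (closure U) := measure_mono subset_closure
      _ = ρ (closure U ∩ S) := Measure.restrict_apply isClosed_closure.measurableSet
      _ ≤ κ * ediam U ^ s := hmain U hU
  have h1 := hle S
  rw [Measure.smul_apply, Measure.restrict_apply_self, smul_eq_mul] at h1
  intro h0
  rw [h0, nonpos_iff_eq_zero, mul_eq_zero, ENNReal.inv_eq_zero] at h1
  exact h1.elim hκt hS

/-- If the mean masses of dyadic balls decay fast enough, every set of full measure has dimension at
least `s`. -/
theorem le_dimH_of_tsum_ballEnergy (ρ : Measure ℝ) [IsFiniteMeasure ρ] (hρ : ρ ≠ 0)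
    {s : NNReal} (hs : 0 < s)
    (h : ∑' n : ℕ, (ENNReal.ofReal (((1 / 2 : ℝ) ^ n) ^ (s : ℝ)))⁻¹ * ballEnergy ρ ((1 / 2) ^ n)
      ≠ ∞) {A : Set ℝ} (hA : ρ Aᶜ = 0) : (s : ℝ≥0∞) ≤ dimH A := by
  have hm : ∀ n : ℕ, Measurable fun x => (ENNReal.ofReal (((1 / 2 : ℝ) ^ n) ^ (s : ℝ)))⁻¹
      * ρ (closedBall x ((1 / 2) ^ n)) := fun n =>
    (RandomIFS.measurable_measure_closedBall ρ _).const_mul _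
  have hI : ∫⁻ x, ∑' n : ℕ, (ENNReal.ofReal (((1 / 2 : ℝ) ^ n) ^ (s : ℝ)))⁻¹
      * ρ (closedBall x ((1 / 2) ^ n)) ∂ρ ≠ ∞ := by
    rw [lintegral_tsum fun n => (hm n).aemeasurable]
    convert h using 3 with n
    rw [lintegral_const_mul _ (RandomIFS.measurable_measure_closedBall ρ _), ballEnergy]
  set S : ℕ → Set ℝ := fun M => {x | ∀ n : ℕ, ρ (closedBall x ((1 / 2) ^ n))
      ≤ M * ENNReal.ofReal (((1 / 2 : ℝ) ^ n) ^ (s : ℝ))} with hS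
  have hcover : ∀ᵐ x ∂ρ, ∃ M, x ∈ S M := by
    filter_upwards [ae_lt_top (Measurable.tsum hm) hI] with x hx
    obtain ⟨M, hM⟩ := ENNReal.exists_nat_gt hx.ne
    refine ⟨M, fun n => ?_⟩
    have h1 := (ENNReal.le_tsum n).trans hM.le
    have hpos : (0 : ℝ) < ((1 / 2 : ℝ) ^ n) ^ (s : ℝ) := by positivity
    rw [mul_comm]
    exact (ENNReal.inv_mul_le_iff (by simpa using hpos) ENNReal.ofReal_ne_top).1 h1
  obtain ⟨M, hM⟩ : ∃ M, ρ (A ∩ S M) ≠ 0 := by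
    by_contra hcon
    push Not at hcon
    refine hρ (Measure.measure_univ_eq_zero.1 ?_)
    have h1 : ρ (⋃ M, A ∩ S M) = 0 := measure_iUnion_null hcon
    rw [measure_eq_zero_iff_ae_notMem] at h1 hA ⊢
    filter_upwards [h1, hA, hcover] with x hx hxA ⟨M, hM⟩ _
    exact hx (Set.mem_iUnion.2 ⟨M, not_not.1 hxA, hM⟩)
  refine (le_dimH_of_hausdorffMeasure_ne_zero ?_).trans (dimH_mono (Set.inter_subset_left (t := S M)))
  exact hausdorffMeasure_ne_zero_of_closedBall_le ρ (by exact_mod_cast hs) hM M fun x hx => hx.2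

end LocalDimension

/-! ### The conditional measures -/

namespace RandomIFS

theorem exists_pos_add_two_mul_neg_and_mul_lt {χ δ t : ℝ} (hχ : χ < 0) (hδ : 0 < δ) (ht : 0 ≤ t) :
    ∃ ε : ℝ, 0 < ε ∧ χ + 2 * ε < 0 ∧ ε * (2 * t + 1) < δ := by
  have h1 : 0 < 2 * t + 1 := by linarith
  refine ⟨min (-χ / 4) (δ / (2 * (2 * t + 1))), lt_min (by linarith) (by positivity), ?_, ?_⟩
  · linarith [min_le_left (-χ / 4) (δ / (2 * (2 * t + 1)))]
  · calc min (-χ / 4) (δ / (2 * (2 * t + 1))) * (2 * t + 1)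
        ≤ δ / (2 * (2 * t + 1)) * (2 * t + 1) := by gcongr; exact min_le_right _ _
      _ = δ / 2 := by field_simp
      _ < δ := by linarith

/-- Absolute continuity of the pieces of `ν_y` carried by sets `W J` that exhaust `μ` passes to `ν_y`. -/
theorem condMeasure_absolutelyContinuous_of_forall {m : ℕ} {d lam : Fin m → ℝ}
    {μ : Measure (Seq m)} {y : ℕ → ℝ} {κ : Measure ℝ} {W : ℕ → Set (Seq m)}
    (hW : ∀ᵐ i ∂μ, ∃ J, i ∈ W J)
    (h : ∀ J, (μ.restrict (W J)).map (proj d lam y) ≪ κ) : condMeasure d lam μ y ≪ κ := by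
  have hm := measurable_proj d lam y
  refine Measure.AbsolutelyContinuous.mk fun A hA hA0 => ?_
  rw [condMeasure, Measure.map_apply hm hA]
  have h1 : ∀ J, μ (proj d lam y ⁻¹' A ∩ W J) = 0 := fun J => by
    have := h J hA0
    rwa [Measure.map_apply hm hA, Measure.restrict_apply (hm hA)] at this
  have h2 := measure_iUnion_null h1
  rw [measure_eq_zero_iff_ae_notMem] at h2 ⊢
  filter_upwards [h2, hW] with i hi ⟨J, hJ⟩ hiA
  exact hi (Set.mem_iUnion.2 ⟨J, hiA, hJ⟩)

/-- There are at most `1 / a` words of length `n` whose cylinder has mass at least `a`. -/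
theorem card_heavy_words_mul_le {m : ℕ} (μ : Measure (Seq m)) [IsProbabilityMeasure μ] (n : ℕ)
    (a : ℝ) :
    (Fintype.card {w : Fin n → Fin m // a ≤ μ.real (wordCylinder w)} : ℝ) * a ≤ 1 := by
  rw [Fintype.card_subtype, ← nsmul_eq_mul]
  have h1 : ∑ w : Fin n → Fin m, μ.real (wordCylinder w) = 1 := by
    have := integral_comp_pref (μ := μ) (n := n) fun _ => (1 : ℝ)
    simpa using this.symm
  rw [← h1]
  refine (Finset.card_nsmul_le_sum _ (fun w : Fin n → Fin m => μ.real (wordCylinder w)) _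
    fun w hw => (Finset.mem_filter.1 hw).2).trans ?_
  exact Finset.sum_le_sum_of_subset_of_nonneg (Finset.filter_subset _ _)
    fun _ _ _ => measureReal_nonneg

variable {m : ℕ} {d lam : Fin m → ℝ} {η : Measure ℝ} [IsProbabilityMeasure η]
  {μ : Measure (Seq m)} [IsProbabilityMeasure μ]

theorem ae_summable_term (hlam : ∀ j, 0 < lam j) (hpos : η (Set.Iic 0) = 0)
    (hlog : Integrable Real.log η) (hμ : Ergodic (shift (m := m)) μ)
    (hχ : lyapunov lam μ η < 0) :
    ∀ᵐ y ∂(Measure.infinitePi fun _ : ℕ => η), ∀ᵐ i ∂μ, Summable (term d lam y i) := by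
  obtain ⟨ε, hε, hχε, -⟩ := exists_pos_add_two_mul_neg_and_mul_lt hχ one_pos le_rfl
  filter_upwards [ae_exists_mem_errorSet hpos hlog hε] with y ⟨K, hy⟩
  filter_upwards [ae_exists_mem_wordSet hμ hlam hε] with i ⟨J, hi⟩
  exact summable_term d hlam hχε hy hi

theorem ae_condMeasure_absolutelyContinuous (hlam : ∀ j, 0 < lam j)
    (hpos : η (Set.Iic 0) = 0) (hac : η ≪ volume) {C₁ : ℝ} (hC₁ : 0 < C₁)
    (hdens : ∀ᵐ x : ℝ, 0 < x → η.rnDeriv volume x ≤ ENNReal.ofReal (C₁ / x))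
    (hlog : Integrable Real.log η) (hμ : Ergodic (shift (m := m)) μ)
    (hχ : lyapunov lam μ η < 0)
    (hcond : (∀ i j, i ≠ j → d i ≠ d j) ∨ ((∀ i, d i = 1) ∧ ∀ i j, i ≠ j → lam i ≠ lam j))
    (hent : |lyapunov lam μ η| < entropy μ) :
    ∀ᵐ y ∂(Measure.infinitePi fun _ : ℕ => η), condMeasure d lam μ y ≪ volume := by
  rw [abs_of_neg hχ] at hent
  obtain ⟨ε, hε, hχε, hsε⟩ := exists_pos_add_two_mul_neg_and_mul_lt hχ
    (show 0 < entropy μ + lyapunov lam μ η by linarith) zero_le_one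
  have hs : 1 * (2 * ε - lyapunov lam μ η) + ε < entropy μ := by linarith
  set c := ∫ t, Real.log t ∂η
  set L := ∫ i : Seq m, Real.log (lam (i 0)) ∂μ
  set W : ℕ → Set (Seq m) := wordSet lam μ L (entropy μ) ε
  set ρ : (ℕ → ℝ) → ℕ → Measure ℝ := fun y J => (μ.restrict (W J)).map (proj d lam y) with hρ
  set r : ℕ → ℝ := fun n => (1 / 2) ^ n
  have hr0 : ∀ n, 0 < r n := fun n => by positivity
  have hr : Tendsto r atTop (𝓝 0) :=
    tendsto_pow_atTop_nhds_zero_of_lt_one (by norm_num) (by norm_num)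
  have hKJ : ∀ K J, ∀ᵐ y ∂(Measure.infinitePi fun _ : ℕ => η), y ∈ errorSet c ε K →
      ρ y J ≪ volume := by
    intro K J
    obtain ⟨C, -, hC⟩ := exists_lintegral_ballEnergy_le (μ := μ) hlam hac hC₁ hdens hcond
      zero_le_one le_rfl hε hχε hs K J
    rw [← ae_restrict_iff' (measurableSet_errorSet c ε K)]
    have hm : ∀ n, Measurable fun y => (ENNReal.ofReal (r n))⁻¹ * ballEnergy (ρ y J) (r n) :=
      fun n => (measurable_ballEnergy_map_proj d lam _ _).const_mul _
    have hfin : ∫⁻ y in errorSet c ε K,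
        liminf (fun n => (ENNReal.ofReal (r n))⁻¹ * ballEnergy (ρ y J) (r n)) atTop
          ∂(Measure.infinitePi fun _ : ℕ => η) ≤ ENNReal.ofReal C := by
      refine (lintegral_liminf_le hm).trans ?_
      refine liminf_le_of_frequently_le' (Frequently.of_forall fun n => ?_)
      rw [lintegral_const_mul _ (measurable_ballEnergy_map_proj d lam _ _),
        ENNReal.inv_mul_le_iff (by simpa using hr0 n) ENNReal.ofReal_ne_top,
        ← ENNReal.ofReal_mul (hr0 n).le, mul_comm]
      simpa using hC (r n) (hr0 n)
    filter_upwards [ae_lt_top (Measurable.liminf hm) (ne_top_of_le_ne_top ENNReal.ofReal_ne_top hfin)]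
      with y hy
    have : IsFiniteMeasure (ρ y J) := by rw [hρ]; infer_instance
    exact absolutelyContinuous_of_liminf_ballEnergy (ρ y J) hr0 hr hy.ne
  filter_upwards [ae_exists_mem_errorSet hpos hlog hε, ae_all_iff.2 fun K => ae_all_iff.2 (hKJ K)]
    with y ⟨K, hy⟩ hy2
  exact condMeasure_absolutelyContinuous_of_forall (ae_exists_mem_wordSet hμ hlam hε)
    fun J => hy2 K J hy

/-- The lower bound for the dimension, for exponents below `h(μ) / |χ|`. -/
theorem ae_le_measureDimH (hlam : ∀ j, 0 < lam j)
    (hpos : η (Set.Iic 0) = 0) (hac : η ≪ volume) {C₁ : ℝ} (hC₁ : 0 < C₁)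
    (hdens : ∀ᵐ x : ℝ, 0 < x → η.rnDeriv volume x ≤ ENNReal.ofReal (C₁ / x))
    (hlog : Integrable Real.log η) (hμ : Ergodic (shift (m := m)) μ)
    (hχ : lyapunov lam μ η < 0)
    (hcond : (∀ i j, i ≠ j → d i ≠ d j) ∨ ((∀ i, d i = 1) ∧ ∀ i j, i ≠ j → lam i ≠ lam j))
    {s : ℝ} (hs0 : 0 < s) (hs1 : s < 1) (hs : s * -lyapunov lam μ η < entropy μ) :
    ∀ᵐ y ∂(Measure.infinitePi fun _ : ℕ => η),
      ENNReal.ofReal s ≤ measureDimH (condMeasure d lam μ y) := by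
  -- an exponent `t` slightly above `s` makes the sum over dyadic scales converge
  obtain ⟨t, hst, ht1, ht⟩ : ∃ t, s < t ∧ t ≤ 1 ∧ t * -lyapunov lam μ η < entropy μ := by
    have h1 : s < entropy μ / -lyapunov lam μ η := by rwa [lt_div_iff₀ (by linarith)]
    obtain ⟨t, ht1, ht2⟩ := exists_between (lt_min hs1 h1)
    refine ⟨t, ht1, (ht2.trans_le (min_le_left _ _)).le, ?_⟩
    rw [← lt_div_iff₀ (by linarith)]
    exact ht2.trans_le (min_le_right _ _)
  obtain ⟨ε, hε, hχε, hsε⟩ := exists_pos_add_two_mul_neg_and_mul_lt hχ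
    (show 0 < entropy μ + t * lyapunov lam μ η by linarith) (hs0.trans hst).le
  have hs' : t * (2 * ε - lyapunov lam μ η) + ε < entropy μ := by linarith
  set c := ∫ t, Real.log t ∂η
  set L := ∫ i : Seq m, Real.log (lam (i 0)) ∂μ
  set W : ℕ → Set (Seq m) := wordSet lam μ L (entropy μ) ε with hW
  obtain ⟨J, hJ⟩ : ∃ J, μ (W J) ≠ 0 := by
    by_contra hcon
    push Not at hcon
    have h1 := measure_iUnion_null hcon
    rw [measure_eq_zero_iff_ae_notMem] at h1
    obtain ⟨i, hi, J, hiJ⟩ := (h1.and (ae_exists_mem_wordSet hμ hlam hε)).exists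
    exact hi (Set.mem_iUnion.2 ⟨J, hiJ⟩)
  set ρ : (ℕ → ℝ) → Measure ℝ := fun y => (μ.restrict (W J)).map (proj d lam y) with hρ
  have hK : ∀ K, ∀ᵐ y ∂(Measure.infinitePi fun _ : ℕ => η), y ∈ errorSet c ε K →
      ∑' n : ℕ, (ENNReal.ofReal (((1 / 2 : ℝ) ^ n) ^ s))⁻¹ * ballEnergy (ρ y) ((1 / 2) ^ n)
        < ∞ := by
    intro K
    obtain ⟨C, hC0, hC⟩ := exists_lintegral_ballEnergy_le (μ := μ) hlam hac hC₁ hdens hcond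
      (hs0.trans hst).le ht1 hε hχε hs' K J
    rw [← ae_restrict_iff' (measurableSet_errorSet c ε K)]
    have hm : ∀ n : ℕ, Measurable fun y => (ENNReal.ofReal (((1 / 2 : ℝ) ^ n) ^ s))⁻¹
        * ballEnergy (ρ y) ((1 / 2) ^ n) :=
      fun n => (measurable_ballEnergy_map_proj d lam _ _).const_mul _
    refine ae_lt_top (Measurable.tsum hm) ?_
    rw [lintegral_tsum fun n => (hm n).aemeasurable]
    have hsum : Summable fun n : ℕ => C * ((1 / 2 : ℝ) ^ (t - s)) ^ n :=
      (summable_geometric_of_lt_one (by positivity)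
        (Real.rpow_lt_one (by norm_num) (by norm_num) (by linarith))).mul_left C
    refine ne_top_of_le_ne_top hsum.tsum_ofReal_ne_top (ENNReal.tsum_le_tsum fun n => ?_)
    have hpos : (0 : ℝ) < ((1 / 2 : ℝ) ^ n) ^ s := by positivity
    rw [lintegral_const_mul _ (measurable_ballEnergy_map_proj d lam _ _),
      ENNReal.inv_mul_le_iff (by simpa using hpos) ENNReal.ofReal_ne_top,
      ← ENNReal.ofReal_mul hpos.le]
    refine (hC _ (by positivity)).trans_eq ?_
    congr 1
    have h1 : ((1 / 2 : ℝ) ^ (t - s)) ^ n = ((1 / 2 : ℝ) ^ n) ^ (t - s) := by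
      rw [← Real.rpow_natCast, ← Real.rpow_natCast, ← Real.rpow_mul (by norm_num),
        ← Real.rpow_mul (by norm_num), mul_comm]
    rw [h1, mul_left_comm, ← Real.rpow_add (by positivity)]
    congr 2
    ring
  filter_upwards [ae_exists_mem_errorSet hpos hlog hε, ae_all_iff.2 hK] with y ⟨K, hy⟩ hy2
  have hm := measurable_proj d lam y
  have hfin : IsFiniteMeasure (ρ y) := by rw [hρ]; infer_instance
  have hne : ρ y ≠ 0 := by
    intro h0
    have h1 : ρ y Set.univ = 0 := by rw [h0]; rfl
    rw [hρ, Measure.map_apply hm MeasurableSet.univ] at h1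
    simp only [Set.preimage_univ, Measure.restrict_apply_univ] at h1
    exact hJ h1
  refine le_iInf₂ fun A hA => ?_
  have hAρ : ρ y Aᶜ = 0 :=
    (Measure.absolutelyContinuous_of_le (Measure.map_mono Measure.restrict_le_self hm)) hA
  have h2 := hy2 K hy
  rw [← Real.coe_toNNReal s hs0.le] at h2
  exact le_dimH_of_tsum_ballEnergy (ρ y) hne (Real.toNNReal_pos.2 hs0) h2.ne hAρ

theorem abs_proj_sub_sum_le {y : ℕ → ℝ} {i : Seq m} {B q : ℝ} (hq0 : 0 ≤ q) (hq1 : q < 1)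
    (h : ∀ n, |term d lam y i n| ≤ B * q ^ n) (n : ℕ) :
    |proj d lam y i - ∑ k ∈ Finset.range n, term d lam y i k| ≤ B * (1 - q)⁻¹ * q ^ n := by
  have hs : Summable (term d lam y i) :=
    Summable.of_norm_bounded ((summable_geometric_of_lt_one hq0 hq1).mul_left B) h
  have h1 : proj d lam y i - ∑ k ∈ Finset.range n, term d lam y i k
      = ∑' k, term d lam y i (k + n) := by
    rw [proj, ← hs.sum_add_tsum_nat_add n, add_sub_cancel_left]
  rw [h1, mul_right_comm, ← Real.norm_eq_abs]
  refine tsum_of_norm_bounded (((hasSum_geometric_of_lt_one hq0 hq1).mul_left (B * q ^ n))) fun k => ?_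
  refine (h (k + n)).trans_eq ?_
  ring

/-- At each scale of the subsequence, only `exp (n (h + ε))` words carry the typical sequences, and
each of them is projected into an interval of length of order `exp (n (χ + 2 ε))`. -/
theorem ae_measureDimH_le (hlam : ∀ j, 0 < lam j)
    (hpos : η (Set.Iic 0) = 0) (hlog : Integrable Real.log η)
    (hμ : Ergodic (shift (m := m)) μ) (hχ : lyapunov lam μ η < 0)
    {s : ℝ} (hs0 : 0 ≤ s) (hs : entropy μ < s * -lyapunov lam μ η) :
    ∀ᵐ y ∂(Measure.infinitePi fun _ : ℕ => η),
      measureDimH (condMeasure d lam μ y) ≤ ENNReal.ofReal s := by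
  obtain ⟨ε, hε, hχε, hsε⟩ := exists_pos_add_two_mul_neg_and_mul_lt hχ
    (show 0 < -(s * lyapunov lam μ η + entropy μ) by linarith) hs0
  obtain ⟨ns, hns, hSMB⟩ := exists_subseq_ae_tendsto_information hμ
  set h := entropy μ with hh
  set c := ∫ t, Real.log t ∂η with hc
  set L := ∫ i : Seq m, Real.log (lam (i 0)) ∂μ with hL
  have hcL : lyapunov lam μ η = c + L := rfl
  rw [hcL] at hχ hs hχε hsε
  set q := Real.exp (c + L + 2 * ε) with hq
  have hq0 : 0 < q := Real.exp_pos _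
  have hq1 : q < 1 := Real.exp_lt_one_iff.2 hχε
  obtain ⟨i₀⟩ : Nonempty (Seq m) := nonempty_of_isProbabilityMeasure μ
  filter_upwards [ae_exists_mem_errorSet hpos hlog hε] with y ⟨K, hy⟩
  -- words are completed to sequences by an arbitrary fixed sequence; only the first `n` letters of
  -- the completion enter the centre of the interval attached to a word
  set fill : ∀ n : ℕ, (Fin n → Fin m) → Seq m := fun n w k => if hk : k < n then w ⟨k, hk⟩ else i₀ k
    with hfill
  set ctr : ∀ n : ℕ, (Fin n → Fin m) → ℝ := fun n w =>
    ∑ k ∈ Finset.range n, term d lam y (fill n w) k with hctr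
  have hctr_pref : ∀ n i, ctr n (pref n i) = ∑ k ∈ Finset.range n, term d lam y i k := by
    intro n i
    have h1 : ∀ k < n, fill n (pref n i) k = i k := fun k hk => by simp [hfill, pref, hk]
    refine Finset.sum_congr rfl fun k hk => ?_
    have hk' := Finset.mem_range.1 hk
    rw [term, term, h1 k hk', Finset.prod_congr rfl fun l hl => by
      rw [h1 l ((Finset.mem_range.1 hl).trans hk')]]
  set R₀ : ℕ → ℝ := fun J => (∑ j, |d j|) * K * J * (1 - q)⁻¹ with hR₀
  have hq2 : 0 ≤ (1 - q)⁻¹ := inv_nonneg.2 (by linarith)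
  have hR₀0 : ∀ J, 0 ≤ R₀ J := fun J => by
    have : 0 ≤ ∑ j, |d j| := Finset.sum_nonneg fun _ _ => abs_nonneg _
    positivity
  let ι : ℕ → Type := fun k =>
    {w : Fin (ns k) → Fin m // Real.exp (-(ns k * (h + ε))) ≤ μ.real (wordCylinder w)}
  let A : ℕ → ℕ → Set ℝ := fun J k₀ =>
    ⋂ k ∈ Set.Ici k₀, ⋃ w : ι k, Metric.closedBall (ctr (ns k) w.1) (R₀ J * q ^ ns k)
  have hAm : ∀ J k₀, MeasurableSet (A J k₀) := fun J k₀ =>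
    MeasurableSet.biInter (Set.to_countable _) fun k _ =>
      MeasurableSet.iUnion fun w => Metric.isClosed_closedBall.measurableSet
  have hcard : ∀ k, (Fintype.card (ι k) : ℝ) ≤ Real.exp (ns k * (h + ε)) := by
    intro k
    have h1 : (Fintype.card (ι k) : ℝ) * Real.exp (-(ns k * (h + ε))) ≤ 1 :=
      card_heavy_words_mul_le μ (ns k) _
    have h2 := mul_le_mul_of_nonneg_right h1 (Real.exp_pos (ns k * (h + ε))).le
    rwa [mul_assoc, ← Real.exp_add, neg_add_cancel, Real.exp_zero, mul_one, one_mul] at h2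
  have hdim : ∀ J k₀, dimH (A J k₀) ≤ ENNReal.ofReal s := by
    intro J k₀
    have hzero : Measure.hausdorffMeasure s (A J k₀) = 0 := by
      have hrad : Tendsto (fun k => ENNReal.ofReal (2 * (R₀ J * q ^ ns k))) atTop (𝓝 0) := by
        have h1 := (tendsto_pow_atTop_nhds_zero_of_lt_one hq0.le hq1).comp hns.tendsto_atTop
        have h2 := ENNReal.tendsto_ofReal ((h1.const_mul (R₀ J)).const_mul 2)
        simpa using h2
      have hle := Measure.hausdorffMeasure_le_liminf_sum s (A J k₀)
        (fun k => ENNReal.ofReal (2 * (R₀ J * q ^ ns k))) hrad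
        (fun k (w : ι k) => Metric.closedBall (ctr (ns k) w.1) (R₀ J * q ^ ns k))
        (Eventually.of_forall fun k w => by
          rw [Real.closedBall_eq_Icc, Real.ediam_Icc]
          exact ENNReal.ofReal_le_ofReal (by linarith))
        (by
          filter_upwards [eventually_ge_atTop k₀] with k hk
          exact Set.biInter_subset_of_mem (t := fun k => ⋃ w : ι k,
            Metric.closedBall (ctr (ns k) w.1) (R₀ J * q ^ ns k)) hk)
      set θ := Real.exp (h + ε + s * (c + L + 2 * ε)) with hθ
      have hθ1 : θ < 1 := Real.exp_lt_one_iff.2 (by linarith)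
      have hlim : Tendsto (fun k => ENNReal.ofReal ((2 * R₀ J) ^ s * θ ^ ns k)) atTop (𝓝 0) := by
        have h1 := (tendsto_pow_atTop_nhds_zero_of_lt_one (Real.exp_pos _).le hθ1).comp
          hns.tendsto_atTop
        have h2 := ENNReal.tendsto_ofReal (h1.const_mul ((2 * R₀ J) ^ s))
        simpa using h2
      refine le_antisymm (hle.trans ?_) zero_le
      rw [← hlim.liminf_eq]
      refine liminf_le_liminf (Eventually.of_forall fun k => ?_)
      calc ∑ w : ι k, Metric.ediam (Metric.closedBall (ctr (ns k) w.1) (R₀ J * q ^ ns k)) ^ s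
          = ∑ _w : ι k, ENNReal.ofReal ((2 * R₀ J * q ^ ns k) ^ s) := by
            refine Finset.sum_congr rfl fun w _ => ?_
            have hnn : 0 ≤ R₀ J := hR₀0 J
            rw [Real.closedBall_eq_Icc, Real.ediam_Icc, ENNReal.ofReal_rpow_of_nonneg _ hs0]
            · congr 2; ring
            · have : 0 ≤ R₀ J * q ^ ns k := by positivity
              linarith
        _ = ENNReal.ofReal (Fintype.card (ι k) * (2 * R₀ J * q ^ ns k) ^ s) := by
            rw [Finset.sum_const, nsmul_eq_mul, ENNReal.ofReal_mul (by positivity),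
              ENNReal.ofReal_natCast]
            rfl
        _ ≤ ENNReal.ofReal ((2 * R₀ J) ^ s * θ ^ ns k) := by
            refine ENNReal.ofReal_le_ofReal ?_
            have hnn : 0 ≤ R₀ J := hR₀0 J
            calc (Fintype.card (ι k) : ℝ) * (2 * R₀ J * q ^ ns k) ^ s
                ≤ Real.exp (ns k * (h + ε)) * (2 * R₀ J * q ^ ns k) ^ s := by
                  gcongr
                  exact hcard k
              _ = (2 * R₀ J) ^ s * θ ^ ns k := by
                  rw [Real.mul_rpow (by positivity) (by positivity), hq, hθ, ← Real.exp_nat_mul,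
                    ← Real.exp_nat_mul, ← Real.exp_mul, mul_left_comm, ← Real.exp_add]
                  congr 2
                  ring
    rw [← Real.coe_toNNReal s hs0] at hzero
    exact dimH_le_of_hausdorffMeasure_ne_top (by rw [hzero]; exact ENNReal.zero_ne_top)
  have hfull : condMeasure d lam μ y (⋃ J, ⋃ k₀, A J k₀)ᶜ = 0 := by
    have hm : MeasurableSet (⋃ J, ⋃ k₀, A J k₀) :=
      MeasurableSet.iUnion fun J => MeasurableSet.iUnion fun k₀ => hAm J k₀
    rw [condMeasure, Measure.map_apply (measurable_proj d lam y) hm.compl,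
      measure_eq_zero_iff_ae_notMem]
    filter_upwards [ae_exists_mem_wordSet hμ hlam hε, hSMB, ae_measureReal_cylinder_pos (μ := μ)]
      with i ⟨J, hi⟩ hlim hposi
    simp only [Set.mem_preimage, Set.mem_compl_iff, not_not]
    have hev := (hlim.eventually (gt_mem_nhds (show h < h + ε by linarith))).and
      (hns.tendsto_atTop.eventually_gt_atTop 0)
    obtain ⟨k₀, hk₀⟩ := eventually_atTop.1 hev
    refine Set.mem_iUnion.2 ⟨J, Set.mem_iUnion.2 ⟨k₀, Set.mem_iInter₂.2 fun k hk => ?_⟩⟩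
    obtain ⟨h1, h2⟩ := hk₀ k hk
    have hn0 : (0 : ℝ) < ns k := Nat.cast_pos.2 h2
    rw [div_lt_iff₀ hn0] at h1
    have h3 : Real.exp (-(ns k * (h + ε))) ≤ μ.real (wordCylinder (pref (ns k) i)) := by
      rw [← Real.le_log_iff_exp_le (hposi _)]
      linarith
    refine Set.mem_iUnion.2 ⟨⟨pref (ns k) i, h3⟩, ?_⟩
    rw [Metric.mem_closedBall, Real.dist_eq, hctr_pref]
    exact abs_proj_sub_sum_le hq0.le hq1 (abs_term_le d hlam hy hi) (ns k)
  have hinf : measureDimH (condMeasure d lam μ y) ≤ dimH (⋃ J, ⋃ k₀, A J k₀) :=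
    iInf_le_of_le (⋃ J, ⋃ k₀, A J k₀) (iInf_le_of_le hfull le_rfl)
  refine hinf.trans ?_
  rw [dimH_iUnion]
  refine iSup_le fun J => ?_
  rw [dimH_iUnion]
  exact iSup_le fun k₀ => hdim J k₀

end RandomIFS

end

theorem theorem2p1 {m : ℕ} (d lam : Fin m → ℝ) (hlam : ∀ j, 0 < lam j)
    -- the law of the error `Y`: a probability measure on `(0, ∞)` with density at most `C₁ / x`
    (η : Measure ℝ) [IsProbabilityMeasure η] (hpos : η (Set.Iic 0) = 0) (hac : η ≪ volume)
    (C₁ : ℝ) (hC₁ : 0 < C₁)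
    (hdens : ∀ᵐ x : ℝ, 0 < x → η.rnDeriv volume x ≤ ENNReal.ofReal (C₁ / x))
    -- `E[log Y]` is a finite number
    (hlog : Integrable Real.log η)
    -- the law of the sequence of maps
    (μ : Measure (RandomIFS.Seq m)) [IsProbabilityMeasure μ]
    (hμ : Ergodic (RandomIFS.shift (m := m)) μ)
    -- contraction on average
    (hχ : RandomIFS.lyapunov lam μ η < 0)
    (hcond : (∀ i j, i ≠ j → d i ≠ d j) ∨
      ((∀ i, d i = 1) ∧ ∀ i j, i ≠ j → lam i ≠ lam j)) :
    -- the series defining the natural projection converges absolutely almost everywhere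
    (∀ᵐ y ∂(Measure.infinitePi fun _ : ℕ => η), ∀ᵐ i ∂μ,
      Summable (RandomIFS.term d lam y i)) ∧
    (|RandomIFS.lyapunov lam μ η| < RandomIFS.entropy μ →
      ∀ᵐ y ∂(Measure.infinitePi fun _ : ℕ => η),
        RandomIFS.condMeasure d lam μ y ≪ volume) ∧
    (RandomIFS.entropy μ ≤ |RandomIFS.lyapunov lam μ η| →
      ∀ᵐ y ∂(Measure.infinitePi fun _ : ℕ => η),
        RandomIFS.measureDimH (RandomIFS.condMeasure d lam μ y) =
          ENNReal.ofReal (RandomIFS.entropy μ / |RandomIFS.lyapunov lam μ η|)) := by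
  refine ⟨RandomIFS.ae_summable_term hlam hpos hlog hμ hχ,
    RandomIFS.ae_condMeasure_absolutelyContinuous hlam hpos hac hC₁ hdens hlog hμ hχ hcond,
    fun hle => ?_⟩
  rw [abs_of_neg hχ] at hle ⊢
  set h := RandomIFS.entropy μ with hh
  set χ := RandomIFS.lyapunov lam μ η with hχdef
  have hχ' : 0 < -χ := neg_pos.2 hχ
  have h0 : 0 ≤ h := RandomIFS.entropy_nonneg hμ.toMeasurePreserving
  have hupper : ∀ᵐ y ∂(Measure.infinitePi fun _ : ℕ => η), ∀ k : ℕ,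
      RandomIFS.measureDimH (RandomIFS.condMeasure d lam μ y)
        ≤ ENNReal.ofReal (h / -χ + 1 / ((k : ℝ) + 1)) := by
    refine ae_all_iff.2 fun k => ?_
    have hk : (0 : ℝ) < 1 / ((k : ℝ) + 1) := Nat.one_div_pos_of_nat
    refine RandomIFS.ae_measureDimH_le hlam hpos hlog hμ hχ (by positivity) ?_
    rw [← div_lt_iff₀ hχ']
    linarith
  have hlower : ∀ᵐ y ∂(Measure.infinitePi fun _ : ℕ => η), ∀ k : ℕ,
      ENNReal.ofReal (h / -χ - h / -χ * (1 / (((k + 1 : ℕ) : ℝ) + 1)))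
        ≤ RandomIFS.measureDimH (RandomIFS.condMeasure d lam μ y) := by
    refine ae_all_iff.2 fun k => ?_
    rcases h0.eq_or_lt with h0 | h0
    · simp [← h0]
    have hk : (0 : ℝ) < 1 / (((k + 1 : ℕ) : ℝ) + 1) := Nat.one_div_pos_of_nat
    have hk1 : 1 / (((k + 1 : ℕ) : ℝ) + 1) < 1 := by
      rw [div_lt_one (by positivity)]
      push_cast
      linarith [k.cast_nonneg (α := ℝ)]
    have hr0 : 0 < h / -χ := div_pos h0 hχ'
    have hr1 : h / -χ ≤ 1 := (div_le_one hχ').2 hle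
    refine RandomIFS.ae_le_measureDimH hlam hpos hac hC₁ hdens hlog hμ hχ hcond ?_ ?_ ?_
    · nlinarith
    · nlinarith
    · rw [← lt_div_iff₀ hχ']
      nlinarith
  have hlim := tendsto_one_div_add_atTop_nhds_zero_nat (𝕜 := ℝ)
  have hlim1 : Tendsto (fun k : ℕ => ENNReal.ofReal (h / -χ + 1 / ((k : ℝ) + 1))) atTop
      (𝓝 (ENNReal.ofReal (h / -χ))) := by
    simpa using ENNReal.tendsto_ofReal (hlim.const_add (h / -χ))
  have hlim2 : Tendsto
      (fun k : ℕ => ENNReal.ofReal (h / -χ - h / -χ * (1 / (((k + 1 : ℕ) : ℝ) + 1)))) atTop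
      (𝓝 (ENNReal.ofReal (h / -χ))) := by
    simpa using ENNReal.tendsto_ofReal
      (((hlim.comp (tendsto_add_atTop_nat 1)).const_mul (h / -χ)).const_sub (h / -χ))
  filter_upwards [hupper, hlower] with y hu hl
  exact le_antisymm (ge_of_tendsto' hlim1 hu) (le_of_tendsto' hlim2 hl)
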